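/- Let $R$ be a commutative ring with unit and let $X$ be a 1-reduced simplicial set, i.e. $X_0=X_1=\{*\}$. All complexes are over $R$ and $|c|$ denotes degree. **Chains of $X$.** $C_*(X)$ is the graded module that is free on the simplices of $X$, modulo all last degeneracies $s_nx$, $x\in X_n$, $n\ge 0$, with $dx=\sum_{i=0}^{n}(-1)^i\partial_ix$ and the Alexander–Whitney diagonal $\Delta x=\sum_{i=0}^{n}\partial_{i+1}\cdots\partial_n x\otimes\partial_0\cdots\partial_{i-1}x$. It is a 1-reduced dg coalgebra: $C_0=R$, $C_1=0$. **Cobar construction and twisted tensor products.** For a 1-reduced dg coalgebra $C$, $\Omega C$ is the tensor algebra on $s^{-1}C_{>0}$ with the derivation determined by $d[\bar c]=-[\overline{dc}]+\sum(-1)^{|c'|}[\bar c'|\bar c'']$, where $\Delta c=c\otimes1+1\otimes c+\sum c'\otimes c''$. A twisting cochain $\varphi:C_*\to A_{*-1}$ satisfies $d\varphi+\varphi d=-\varphi\smile\varphi$, $(\varphi\smile\varphi)(c)=\sum(-1)^{|c'|}\varphi(c')\varphi(c'')$ (here over all terms of $\Delta c$), and for an $A$-module $M$, $C\otimes_\varphi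 M$ is $C\otimes M$ with $d_\varphi(c\otimes m)=dc\otimes m+(-1)^{|c|}c\otimes dm+\sum(-1)^{|c'|}c'\otimes\varphi(c'')m$. The acyclic cobar construction is $\Omega(C;C)=C\otimes_{\varphi}\Omega C$ for the universal twisting cochain $\varphi(c)=-[\bar c]$ for $|c|>0$, $\varphi(C_0)=0$. **Cubical sets.** Cubical sets $Q$ have face operators $d_i^0,d_i^1$ ($1\le i\le n$) and degeneracy operators $\eta_i$ ($1\le i\le n+1$) on $Q_n$. $C^\square_*(Q)$ is the free module on $Q$ modulo degenerate elements, with $dx=\sum_{i=1}^n(-1)^i(d_i^0x-d_i^1x)$. A monoidal cubical set $Q$ has an associative cubical multiplication $Q\times Q\to Q$ with unit $e\in Q_0$, and a cubical $Q$-module $L$ has an associative unital cubical action $Q\times L\to L$, where products of cubical sets are taken modulo $(\eta_{p+1}a,b)\sim(a,\eta_1b)$, $a$ of degree $p$. **The monoidal cubical set $\mathbf\Omega X$.** It is generated, as a monoid with freely adjoined degeneracies, by letters $\bar x$ of degree $n-1$ for $x\in X_n$, $n\ge1$, where $\bar x=e$ for the 1-simplex $x$, and $\eta_n\bar x=\overline{s_nx}$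 for $x\in X_n$, $n\ge 1$; products satisfy $\eta_{p+1}(a)b=a\,\eta_1(b)$, $a$ of degree $p$. Its faces are determined by $d_i^0\bar x=\overline{\partial_{i+1}\cdots\partial_nx}\cdot\overline{\partial_0\cdots\partial_{i-1}x}$ and $d_i^1\bar x=\overline{\partial_ix}$, $1\le i\le n-1$. **Truncating twisting functions.** These are sequences $\tau_n:X_n\to Q_{n-1}$, $n\ge1$, with $\tau(x)=e$ for $x\in X_1$, and, for $x\in X_n$, $d_i^0\tau(x)=\tau(\partial_{i+1}\cdots\partial_nx)\cdot\tau(\partial_0\cdots\partial_{i-1}x)$, $d_i^1\tau(x)=\tau(\partial_ix)$ $(1\le i\le n-1)$, $\eta_n\tau(x)=\tau(s_nx)$. The universal one is $\tau_U:X\to\mathbf\Omega X$, $x\mapsto\bar x$. Let $\tau_*(x)=-\tau(x)$ for $\dim x\ge2$ and $\tau_*(x)=0$ for $\dim x\le1$. **Twisted Cartesian products.** $X\times_\tau L$ is the cubical set generated, with freely adjoined degeneracies, by pairs $(x,y)$ of degree $p+q$ $(x\in X_p,\ y\in L_q)$, with $\eta_{p+j}(x,y)=(x,\eta_jy)$ for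 $1\le j\le q+1$, $\eta_{p+1}(x,y)=(s_px,y)$, and faces $d_i^0(x,y)=(\partial_i\cdots\partial_px,\ \tau(\partial_0\cdots\partial_{i-2}x)\cdot y)$ and $d^1_i(x,y)=(\partial_{i-1}x,y)$ for $1\le i\le p$ (for $i=1$ the argument of $\tau$ is $x$), and $d_i^\epsilon(x,y)=(x,d^\epsilon_{i-p}y)$ for $i>p$. Put $\mathbf PX=X\times_{\tau_U}\mathbf\Omega X$. **Theorem.** All objects below are chain complexes, $\tau_*$ and the universal $\varphi$ are twisting cochains, and there are isomorphisms of chain complexes (identifications of the canonical generators): (i) $C^\square_*(\mathbf\Omega X)=\Omega C_*(X)$, an isomorphism of dg algebras, with $\bar x\leftrightarrow[\bar x]$ for $\dim x\ge2$; (ii) $C^\square_*(\mathbf PX)=\Omega(C_*(X);C_*(X))$, with $(x,y)\leftrightarrow x\otimes y$ for $y\in\mathbf\Omega X$, where $y$ is regarded as an element of $\Omega C_*(X)$ through (i); (iii) for every monoidal cubical set $Q$, every cubical $Q$-module $L$ and every truncating twisting function $\tau:X\to Q$, $C^\square_*(X\times_\tau L)=C_*(X)\otimes_{\tau_*}C^\square_*(L)$,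 with $(x,y)\leftrightarrow x\otimes y$. -/

import Mathlib

universe u v w t

open scoped TensorProduct

noncomputable section

open CategoryTheory Opposite

section

open Simplicial

/-! ### Simplices of a simplicial set -/

/-- The graded set of all simplices of a simplicial set. -/
def Simplex (X : SSet.{u}) : Type u := Σ n : ℕ, X _⦋n⦌

namespace Simplex

variable {X : SSet.{u}}

/-- The dimension of a simplex. -/
def dim (x : Simplex X) : ℕ := x.1

/-- The monotone map `{0,…,m} → {0,…,n}` given by `f` (values above `n` are cut off at `n`). -/
def vertexMap (m n : ℕ) (f : ℕ → ℕ) (hf : Monotone f) : ⦋m⦌ ⟶ ⦋n⦌ :=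
  SimplexCategory.mkHom
    ⟨fun i => ⟨min (f i) n, by omega⟩, fun i j h => by
      have := hf (show (i : ℕ) ≤ j from h)
      simp only [Fin.mk_le_mk]; omega⟩

/-- The `m`-simplex with vertices `f 0, …, f m` of a simplex `x`, that is, the simplex `f^* x`. -/
def restrict (m : ℕ) (f : ℕ → ℕ) (hf : Monotone f) (x : Simplex X) : Simplex X :=
  ⟨m, X.map (vertexMap m x.1 f hf).op x.2⟩

theorem monotone_face (j : ℕ) : Monotone (fun v : ℕ => if v < j then v else v + 1) := by
  intro a b h; grind

theorem monotone_degen (j : ℕ) : Monotone (fun v : ℕ => if v ≤ j then v else v - 1) := by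
  intro a b h; grind

theorem monotone_front : Monotone (fun v : ℕ => v) := fun _ _ h => h

theorem monotone_back (k : ℕ) : Monotone (fun v : ℕ => v + k) :=
  fun _ _ h => Nat.add_le_add_right h k

/-- The face operator `∂_j`, for `0 ≤ j ≤ dim x` and `dim x ≥ 1`. -/
def face (j : ℕ) (x : Simplex X) : Simplex X :=
  restrict (x.dim - 1) (fun v => if v < j then v else v + 1) (monotone_face j) x

/-- The degeneracy operator `s_j`, for `0 ≤ j ≤ dim x`. -/
def degen (j : ℕ) (x : Simplex X) : Simplex X :=
  restrict (x.dim + 1) (fun v => if v ≤ j then v else v - 1) (monotone_degen j) x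

/-- The front face `∂_{k+1} ⋯ ∂_n x`, with vertices `0, …, k`, for `0 ≤ k ≤ n = dim x`. -/
def front (k : ℕ) (x : Simplex X) : Simplex X :=
  restrict k (fun v => v) monotone_front x

/-- The back face `∂_0 ⋯ ∂_{k-1} x`, with vertices `k, …, n`, for `0 ≤ k ≤ n = dim x`. -/
def back (k : ℕ) (x : Simplex X) : Simplex X :=
  restrict (x.dim - k) (fun v => v + k) (monotone_back k) x

theorem restrict_congr (m m' : ℕ) (f g : ℕ → ℕ) (hf : Monotone f) (hg : Monotone g)
    (x : Simplex X) (hm : m = m') (H : ∀ v ≤ m, min (f v) x.dim = min (g v) x.dim) :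
    restrict m f hf x = restrict m' g hg x := by
  subst hm
  have : vertexMap m x.1 f hf = vertexMap m x.1 g hg := by
    ext i
    exact H i (by have := i.2; simp at this; omega)
  unfold restrict
  rw [this]

theorem restrict_restrict (m k : ℕ) (f g : ℕ → ℕ) (hf : Monotone f) (hg : Monotone g)
    (x : Simplex X) :
    restrict m f hf (restrict k g hg x) = restrict m (fun v => g (min (f v) k))
      (by intro a b h; exact hg (by have := hf h; omega)) x := by
  have : vertexMap m k f hf ≫ vertexMap k x.1 g hg = vertexMap m x.1 (fun v => g (min (f v) k))
      (by intro a b h; exact hg (by have := hf h; omega)) := rfl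
  unfold restrict
  rw [← this, op_comp, X.map_comp]
  rfl

theorem restrict_self (m : ℕ) (f : ℕ → ℕ) (hf : Monotone f) (x : Simplex X) (hm : m = x.dim)
    (H : ∀ v ≤ m, min (f v) x.dim = v) : restrict m f hf x = x := by
  subst hm
  have : vertexMap x.1 x.1 f hf = 𝟙 _ := by
    ext i
    have := i.2
    simp at this
    exact H i (by unfold dim; omega)
  unfold restrict dim
  rw [this, op_id, X.map_id]
  rfl

@[simp] theorem dim_restrict (m : ℕ) (f : ℕ → ℕ) (hf : Monotone f) (x : Simplex X) :
    (restrict m f hf x).dim = m := rfl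
@[simp] theorem dim_face (j : ℕ) (x : Simplex X) : (face j x).dim = x.dim - 1 := rfl
@[simp] theorem dim_degen (j : ℕ) (x : Simplex X) : (degen j x).dim = x.dim + 1 := rfl
@[simp] theorem dim_front (k : ℕ) (x : Simplex X) : (front k x).dim = k := rfl
@[simp] theorem dim_back (k : ℕ) (x : Simplex X) : (back k x).dim = x.dim - k := rfl

theorem face_mk (n : ℕ) (j : Fin (n + 2)) (x : X _⦋n + 1⦌) :
    face j (⟨n + 1, x⟩ : Simplex X) = ⟨n, X.δ j x⟩ := by
  have : vertexMap n (n + 1) (fun v => if v < j then v else v + 1) (monotone_face j) =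
      SimplexCategory.δ j := by
    ext i
    have hi := i.2
    simp only [SimplexCategory.len_mk] at hi
    change min (if (i : ℕ) < j then (i : ℕ) else i + 1) (n + 1) = (Fin.succAbove j i : ℕ)
    simp only [Fin.succAbove, Fin.lt_def]
    split_ifs <;> simp_all
    omega
  change (⟨n, X.map (vertexMap n (n + 1) _ _).op x⟩ : Simplex X) = _
  rw [this]
  rfl

theorem degen_mk (n : ℕ) (j : Fin (n + 1)) (x : X _⦋n⦌) :
    degen j (⟨n, x⟩ : Simplex X) = ⟨n + 1, X.σ j x⟩ := by
  have : vertexMap (n + 1) n (fun v => if v ≤ j then v else v - 1) (monotone_degen j) =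
      SimplexCategory.σ j := by
    ext i
    have hi := i.2
    have hj := j.2
    simp only [SimplexCategory.len_mk] at hi
    change min (if (i : ℕ) ≤ j then (i : ℕ) else i - 1) n = (Fin.predAbove j i : ℕ)
    simp only [Fin.predAbove, Fin.lt_def, Fin.val_castSucc]
    split_ifs <;> simp_all <;> omega
  change (⟨n + 1, X.map (vertexMap (n + 1) n _ _).op x⟩ : Simplex X) = _
  rw [this]
  rfl

theorem front_front (i j : ℕ) (x : Simplex X) (h : i ≤ j) :
    front i (front j x) = front i x := by
  unfold front
  simp only [restrict_restrict, dim_restrict]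
  refine restrict_congr _ _ _ _ _ _ _ ?_ fun v hv => ?_
  · rfl
  · omega

theorem back_front (i j : ℕ) (x : Simplex X) (h : i ≤ j) :
    back i (front j x) = front (j - i) (back i x) := by
  unfold back front
  simp only [restrict_restrict, dim_restrict]
  refine restrict_congr _ _ _ _ _ _ _ ?_ fun v hv => ?_
  · omega
  · (repeat' split_ifs) <;> omega

theorem back_back (i j : ℕ) (x : Simplex X) (h : i + j ≤ x.dim) :
    back i (back j x) = back (j + i) x := by
  unfold back
  simp only [restrict_restrict, dim_restrict]
  refine restrict_congr _ _ _ _ _ _ _ ?_ fun v hv => ?_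
  · omega
  · (repeat' split_ifs) <;> omega

theorem front_face_of_le (j k : ℕ) (x : Simplex X) (h : j ≤ k) (hk : k + 1 ≤ x.dim) :
    front k (face j x) = face j (front (k + 1) x) := by
  unfold front face
  simp only [restrict_restrict, dim_restrict]
  refine restrict_congr _ _ _ _ _ _ _ ?_ fun v hv => ?_
  · omega
  · (repeat' split_ifs) <;> omega

theorem front_face_of_lt (j k : ℕ) (x : Simplex X) (h : k < j) (hk : k + 1 ≤ x.dim) :
    front k (face j x) = front k x := by
  unfold front face
  simp only [restrict_restrict, dim_restrict]
  refine restrict_congr _ _ _ _ _ _ _ ?_ fun v hv => ?_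
  · omega
  · (repeat' split_ifs) <;> omega

theorem back_face_of_le (j k : ℕ) (x : Simplex X) (h : j ≤ k) (hk : k + 1 ≤ x.dim) :
    back k (face j x) = back (k + 1) x := by
  unfold back face
  simp only [restrict_restrict, dim_restrict]
  refine restrict_congr _ _ _ _ _ _ _ ?_ fun v hv => ?_
  · omega
  · (repeat' split_ifs) <;> omega

theorem back_face_of_ge (j k : ℕ) (x : Simplex X) (h : k ≤ j) (hk : k + 1 ≤ x.dim) :
    back k (face j x) = face (j - k) (back k x) := by
  unfold back face
  simp only [restrict_restrict, dim_restrict]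
  refine restrict_congr _ _ _ _ _ _ _ ?_ fun v hv => ?_
  · omega
  · (repeat' split_ifs) <;> omega

theorem face_face (i j : ℕ) (x : Simplex X) (h : i ≤ j) (hj : j + 1 ≤ x.dim) (hx : 2 ≤ x.dim) :
    face j (face i x) = face i (face (j + 1) x) := by
  unfold face
  simp only [restrict_restrict, dim_restrict]
  refine restrict_congr _ _ _ _ _ _ _ ?_ fun v hv => ?_
  · omega
  · (repeat' split_ifs) <;> omega

theorem face_degen_of_lt (i : ℕ) (x : Simplex X) (h : i < x.dim) :
    face i (degen x.dim x) = degen (x.dim - 1) (face i x) := by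
  unfold face degen
  simp only [restrict_restrict, dim_restrict]
  refine restrict_congr _ _ _ _ _ _ _ ?_ fun v hv => ?_
  · omega
  · (repeat' split_ifs) <;> omega

theorem face_degen_self (i : ℕ) (x : Simplex X) (h : x.dim ≤ i) :
    face i (degen x.dim x) = x := by
  unfold face degen
  simp only [restrict_restrict, dim_restrict]
  refine restrict_self _ _ _ _ (by omega) fun v hv => ?_
  (repeat' split_ifs) <;> omega

theorem front_degen (k : ℕ) (x : Simplex X) (h : k ≤ x.dim) :
    front k (degen x.dim x) = front k x := by
  unfold front degen
  simp only [restrict_restrict, dim_restrict]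
  refine restrict_congr _ _ _ _ _ _ _ ?_ fun v hv => ?_
  · omega
  · (repeat' split_ifs) <;> omega

theorem back_degen (k : ℕ) (x : Simplex X) (h : k ≤ x.dim) :
    back k (degen x.dim x) = degen (x.dim - k) (back k x) := by
  unfold back degen
  simp only [restrict_restrict, dim_restrict]
  refine restrict_congr _ _ _ _ _ _ _ ?_ fun v hv => ?_
  · omega
  · (repeat' split_ifs) <;> omega

theorem front_self (x : Simplex X) : front x.dim x = x :=
  restrict_self _ _ _ _ rfl fun v hv => by omega

theorem back_zero (x : Simplex X) : back 0 x = x :=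
  restrict_self _ _ _ _ rfl fun v hv => by omega

end Simplex

/-- A simplicial set is 1-reduced if it has exactly one 0-simplex and exactly one 1-simplex. -/
def OneReduced (X : SSet.{u}) : Prop :=
  Nat.card (X _⦋0⦌) = 1 ∧ Nat.card (X _⦋1⦌) = 1

end

/-! ### Cubical sets

A cubical set is a graded set with operators `d_i^ε`, `η_i`.  Indices are shifted to start at `0`:
`face false i` is `d^0_{i+1}`, `face true i` is `d^1_{i+1}` (for `i < dim x`), and `degen i` is
`η_{i+1}` (for `i ≤ dim x`).  Values of the operators outside these ranges carry no meaning. -/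

/-- Cubical sets (without connections). -/
structure CubicalSet where
  carrier : Type u
  dim : carrier → ℕ
  face : Bool → ℕ → carrier → carrier
  degen : ℕ → carrier → carrier
  dim_face : ∀ ε i x, i < dim x → dim (face ε i x) + 1 = dim x
  dim_degen : ∀ i x, i ≤ dim x → dim (degen i x) = dim x + 1
  face_face : ∀ ε ε' i j x, i ≤ j → j + 1 < dim x →
    face ε j (face ε' i x) = face ε' i (face ε (j + 1) x)
  face_degen_of_lt : ∀ ε i j x, i < j → j ≤ dim x →
    face ε i (degen j x) = degen (j - 1) (face ε i x)
  face_degen_self : ∀ ε i x, i ≤ dim x → face ε i (degen i x) = x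
  face_degen_of_gt : ∀ ε i j x, j < i → i ≤ dim x →
    face ε i (degen j x) = degen j (face ε (i - 1) x)
  degen_degen : ∀ i j x, i ≤ j → j ≤ dim x →
    degen i (degen j x) = degen (j + 1) (degen i x)

/-- Monoidal cubical sets: the multiplication is an associative unital cubical map `Q × Q → Q` from
the tensor product; both formulas of `degen_mul_left` and `degen_mul_right` apply at `i = dim a`,
which is the compatibility with the relation `(η_{p+1} a, b) ∼ (a, η_1 b)`. -/
structure MonoidalCubicalSet extends CubicalSet.{u} where
  one : carrier
  mul : carrier → carrier → carrier
  dim_one : dim one = 0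
  dim_mul : ∀ a b, dim (mul a b) = dim a + dim b
  one_mul : ∀ a, mul one a = a
  mul_one : ∀ a, mul a one = a
  mul_assoc : ∀ a b c, mul (mul a b) c = mul a (mul b c)
  face_mul_left : ∀ ε i a b, i < dim a → face ε i (mul a b) = mul (face ε i a) b
  face_mul_right : ∀ ε i a b, i < dim b → face ε (dim a + i) (mul a b) = mul a (face ε i b)
  degen_mul_left : ∀ i a b, i ≤ dim a → degen i (mul a b) = mul (degen i a) b
  degen_mul_right : ∀ i a b, i ≤ dim b → degen (dim a + i) (mul a b) = mul a (degen i b)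

/-- Modules over a monoidal cubical set `Q`: cubical sets `L` with an associative unital cubical
map `Q × L → L` from the tensor product. -/
structure CubicalModule (Q : MonoidalCubicalSet.{v}) extends CubicalSet.{w} where
  act : Q.carrier → carrier → carrier
  dim_act : ∀ a y, dim (act a y) = Q.dim a + dim y
  one_act : ∀ y, act Q.one y = y
  mul_act : ∀ a b y, act (Q.mul a b) y = act a (act b y)
  face_act_left : ∀ ε i a y, i < Q.dim a → face ε i (act a y) = act (Q.face ε i a) y
  face_act_right : ∀ ε i a y, i < dim y → face ε (Q.dim a + i) (act a y) = act a (face ε i y)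
  degen_act_left : ∀ i a y, i ≤ Q.dim a → degen i (act a y) = act (Q.degen i a) y
  degen_act_right : ∀ i a y, i ≤ dim y → degen (Q.dim a + i) (act a y) = act a (degen i y)

/-- A monoidal cubical set is a module over itself. -/
def MonoidalCubicalSet.selfModule (Q : MonoidalCubicalSet.{u}) : CubicalModule Q where
  toCubicalSet := Q.toCubicalSet
  act := Q.mul
  dim_act := Q.dim_mul
  one_act := Q.one_mul
  mul_act := Q.mul_assoc
  face_act_left := Q.face_mul_left
  face_act_right := Q.face_mul_right
  degen_act_left := Q.degen_mul_left
  degen_act_right := Q.degen_mul_right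

/-! ### Adjoining formal degeneracies -/

/-- A cubical set without degeneracies, in which some elements are declared to be degenerate:
`IsDegen k g h` says that `g` is to become `η_{k+1} h`. -/
structure SemiCubicalSet where
  carrier : Type u
  dim : carrier → ℕ
  face : Bool → ℕ → carrier → carrier
  dim_face : ∀ ε i x, i < dim x → dim (face ε i x) + 1 = dim x
  face_face : ∀ ε ε' i j x, i ≤ j → j + 1 < dim x →
    face ε j (face ε' i x) = face ε' i (face ε (j + 1) x)
  IsDegen : ℕ → carrier → carrier → Prop
  dim_of_isDegen : ∀ k g h, IsDegen k g h → dim g = dim h + 1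
  face_of_isDegen_lt : ∀ ε i k g h, IsDegen k g h → i < k → k ≤ dim h →
    IsDegen (k - 1) (face ε i g) (face ε i h)
  face_of_isDegen_self : ∀ ε k g h, IsDegen k g h → k ≤ dim h → face ε k g = h
  face_of_isDegen_gt : ∀ ε i k g h, IsDegen k g h → k < i → i ≤ dim h →
    IsDegen k (face ε i g) (face ε (i - 1) h)

namespace SemiCubicalSet

variable (P : SemiCubicalSet.{u})

/-- Formal degeneracies of elements of `P`, in normal form.  The entry `(g, m)` has one Boolean for
each of its coordinates: `true` for the coordinates of `g`, in their order, and `false` for the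
coordinates added by degeneracy operators. -/
abbrev Formal : Type u := {p : P.carrier × List Bool // p.2.count true = P.dim p.1}

variable {P}

/-- The face operators on formal degeneracies: removal of an added coordinate, or a face of `g`. -/
def rawFace (ε : Bool) (i : ℕ) (p : P.carrier × List Bool) : P.carrier × List Bool :=
  match p.2[i]? with
  | none => p
  | some false => (p.1, p.2.take i ++ p.2.drop (i + 1))
  | some true => (P.face ε ((p.2.take i).count true) p.1, p.2.take i ++ p.2.drop (i + 1))

/-- The degeneracy operators on formal degeneracies: insertion of an added coordinate. -/
def rawDegen (i : ℕ) (p : P.carrier × List Bool) : P.carrier × List Bool :=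
  (p.1, p.2.take i ++ false :: p.2.drop i)

theorem rawFace_split (ε x : Bool) (i : ℕ) (g : P.carrier) (a b : List Bool)
    (hi : i = a.length) :
    rawFace ε i (g, a ++ x :: b) = (if x then P.face ε (a.count true) g else g, a ++ b) := by
  subst hi
  cases x <;> simp [rawFace]

theorem rawFace_of_le (ε : Bool) (i : ℕ) (g : P.carrier) (m : List Bool) (hi : m.length ≤ i) :
    rawFace ε i (g, m) = (g, m) := by
  simp [rawFace, List.getElem?_eq_none hi]

theorem rawDegen_split (i : ℕ) (g : P.carrier) (a b : List Bool) (hi : i = a.length) :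
    rawDegen i (g, a ++ b) = (g, a ++ false :: b) := by
  subst hi
  simp [rawDegen]

theorem rawDegen_of_le (i : ℕ) (g : P.carrier) (m : List Bool) (hi : m.length ≤ i) :
    rawDegen i (g, m) = (g, m ++ [false]) := by
  simp [rawDegen, List.take_of_length_le hi, List.drop_of_length_le hi]

theorem exists_split (m : List Bool) (i : ℕ) (h : i < m.length) :
    ∃ a x b, m = a ++ x :: b ∧ i = a.length :=
  ⟨m.take i, m[i], m.drop (i + 1), by simp, by simp; omega⟩

theorem exists_cut (m : List Bool) (i : ℕ) (h : i ≤ m.length) :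
    ∃ a b, m = a ++ b ∧ i = a.length :=
  ⟨m.take i, m.drop i, by simp, by simp; omega⟩

/-- Face operators of formal degeneracies. -/
def Formal.face (ε : Bool) (i : ℕ) (p : P.Formal) : P.Formal :=
  ⟨rawFace ε i p.1, by
    obtain ⟨⟨g, m⟩, hm⟩ := p
    rcases lt_or_ge i m.length with h | h
    · obtain ⟨a, x, b, rfl, hi⟩ := exists_split m i h
      rw [rawFace_split ε x i g a b hi]
      cases x
      · simpa using hm
      · have := P.dim_face ε (a.count true) g (by simp at hm; omega)
        simp at hm ⊢
        omega
    · rw [rawFace_of_le ε i g m h]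
      exact hm⟩

/-- Degeneracy operators of formal degeneracies. -/
def Formal.degen (i : ℕ) (p : P.Formal) : P.Formal :=
  ⟨rawDegen i p.1, by
    obtain ⟨⟨g, m⟩, hm⟩ := p
    rcases le_total i m.length with h | h
    · obtain ⟨a, b, rfl, hi⟩ := exists_cut m i h
      rw [rawDegen_split i g a b hi]
      simpa using hm
    · rw [rawDegen_of_le i g m h]
      simpa using hm⟩

/-- A degenerate element of `P` is identified with the formal degeneracy that it is meant to be
(and the same for all formal degeneracies of these two). -/
inductive DegenRel : P.Formal → P.Formal → Prop where
  | mk (g h : P.carrier) (a b : List Bool) (hd : P.IsDegen (a.count true) g h)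
      (hg : (a ++ true :: b).count true = P.dim g)
      (hh : (a ++ false :: b).count true = P.dim h) :
      DegenRel ⟨(g, a ++ true :: b), hg⟩ ⟨(h, a ++ false :: b), hh⟩

theorem DegenRel.of_eq {p q : P.Formal} (g h : P.carrier) (a b : List Bool)
    (hd : P.IsDegen (a.count true) g h) (hp : p.1 = (g, a ++ true :: b))
    (hq : q.1 = (h, a ++ false :: b)) : DegenRel p q := by
  obtain ⟨p, hp'⟩ := p
  obtain ⟨q, hq'⟩ := q
  subst hp hq
  exact .mk g h a b hd _ _

variable (P) in
/-- Elements of the cubical set generated by `P`. -/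
def Cubes : Type u := Quot (DegenRel (P := P))

theorem face_rel (ε : Bool) (i : ℕ) (p q : P.Formal) (h : DegenRel p q) :
    Quot.mk DegenRel (p.face ε i) = Quot.mk DegenRel (q.face ε i) := by
  obtain ⟨g, h, a, b, hd, hg, hh⟩ := h
  have hc : (a ++ false :: b).count true = a.count true + b.count true := by simp
  have hle : a.count true ≤ P.dim h := by omega
  rcases lt_trichotomy i a.length with hi | hi | hi
  · obtain ⟨a, x, a', rfl, hi'⟩ := exists_split a i hi
    apply Quot.sound
    cases x
    · refine .of_eq g h (a ++ a') b (by simpa using hd) ?_ ?_ <;>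
      simp only [Formal.face, List.append_assoc, List.cons_append] <;>
      rw [rawFace_split _ _ _ _ _ _ hi'] <;> simp
    · have := P.face_of_isDegen_lt ε (a.count true) _ _ _ hd (by simp) hle
      refine .of_eq _ _ (a ++ a') b (by simpa using this) ?_ ?_ <;>
      simp only [Formal.face, List.append_assoc, List.cons_append] <;>
      rw [rawFace_split _ _ _ _ _ _ hi'] <;> simp
  · congr 1
    apply Subtype.ext
    simp only [Formal.face]
    rw [rawFace_split _ _ _ _ _ _ hi, rawFace_split _ _ _ _ _ _ hi]
    simp [P.face_of_isDegen_self ε _ _ _ hd hle]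
  · apply Quot.sound
    rcases lt_or_ge i (a ++ true :: b).length with hi2 | hi2
    · obtain ⟨b, x, b', rfl, hi'⟩ := exists_split b (i - a.length - 1) (by simp at hi2; omega)
      have e1 : rawFace ε i (g, a ++ true :: (b ++ x :: b')) =
          (if x then P.face ε ((a ++ true :: b).count true) g else g, (a ++ true :: b) ++ b') := by
        rw [← List.cons_append, ← List.append_assoc]
        exact rawFace_split _ _ _ _ _ _ (by simp; omega)
      have e2 : rawFace ε i (h, a ++ false :: (b ++ x :: b')) =
          (if x then P.face ε ((a ++ false :: b).count true) h else h,
            (a ++ false :: b) ++ b') := by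
        rw [← List.cons_append, ← List.append_assoc]
        exact rawFace_split _ _ _ _ _ _ (by simp; omega)
      cases x
      · refine .of_eq g h a (b ++ b') hd ?_ ?_
        · simp only [Formal.face, e1]; simp
        · simp only [Formal.face, e2]; simp
      · have := P.face_of_isDegen_gt ε ((a ++ true :: b).count true) _ _ _ hd (by simp)
          (by simp at hc ⊢; simp at hh; omega)
        refine .of_eq _ _ a (b ++ b') this ?_ ?_
        · simp only [Formal.face, e1]; simp
        · simp only [Formal.face, e2]; simp [← add_assoc]
    · refine .of_eq g h a b hd ?_ ?_
      · simp only [Formal.face, rawFace_of_le ε i g _ hi2]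
      · simp only [Formal.face]
        rw [rawFace_of_le ε i h _ (by simpa using hi2)]

theorem degen_rel (i : ℕ) (p q : P.Formal) (h : DegenRel p q) : DegenRel (p.degen i) (q.degen i) := by
  obtain ⟨g, h, a, b, hd, hg, hh⟩ := h
  rcases le_or_gt i a.length with hi | hi
  · obtain ⟨a, a', rfl, hi'⟩ := exists_cut a i hi
    refine .of_eq g h (a ++ false :: a') b (by simpa using hd) ?_ ?_ <;>
    simp only [Formal.degen, List.append_assoc] <;>
    rw [rawDegen_split _ _ _ _ hi'] <;> simp
  · rcases le_or_gt i (a ++ true :: b).length with hi2 | hi2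
    · obtain ⟨b, b', rfl, hi'⟩ := exists_cut b (i - a.length - 1) (by simp at hi2; omega)
      have e1 : rawDegen i (g, a ++ true :: (b ++ b')) = (g, (a ++ true :: b) ++ false :: b') := by
        rw [← List.cons_append, ← List.append_assoc]
        exact rawDegen_split _ _ _ _ (by simp; omega)
      have e2 : rawDegen i (h, a ++ false :: (b ++ b')) = (h, (a ++ false :: b) ++ false :: b') := by
        rw [← List.cons_append, ← List.append_assoc]
        exact rawDegen_split _ _ _ _ (by simp; omega)
      refine .of_eq g h a (b ++ false :: b') hd ?_ ?_
      · simp only [Formal.degen, e1]; simp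
      · simp only [Formal.degen, e2]; simp
    · refine .of_eq g h a (b ++ [false]) hd ?_ ?_
      · simp only [Formal.degen]
        rw [rawDegen_of_le i g _ (by omega)]; simp
      · simp only [Formal.degen]
        rw [rawDegen_of_le i h _ (by simp at hi2 ⊢; omega)]; simp

theorem length_rel (p q : P.Formal) (h : DegenRel p q) : p.1.2.length = q.1.2.length := by
  obtain ⟨g, h, a, b, hd, hg, hh⟩ := h
  simp

variable (P) in
/-- The cubical set generated by `P`: every element is a formal degeneracy of an element of `P`, and
the prescribed degeneracies hold. -/
def toCubicalSet : CubicalSet.{u} where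
  carrier := P.Cubes
  dim := Quot.lift (fun p => p.1.2.length) length_rel
  face ε i := Quot.lift (fun p => Quot.mk DegenRel (p.face ε i)) (face_rel ε i)
  degen i := Quot.lift (fun p => Quot.mk DegenRel (p.degen i)) fun p q h => Quot.sound (degen_rel i p q h)
  dim_face ε i := by
    rintro ⟨⟨g, m⟩, hm⟩ h
    obtain ⟨a, x, b, rfl, hi⟩ := exists_split m i h
    change (rawFace ε i _).2.length + 1 = (a ++ x :: b).length
    rw [rawFace_split _ _ _ _ _ _ hi]
    simp; omega
  dim_degen i := by
    rintro ⟨⟨g, m⟩, hm⟩ h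
    obtain ⟨a, b, rfl, hi⟩ := exists_cut m i h
    change (rawDegen i _).2.length = (a ++ b).length + 1
    rw [rawDegen_split _ _ _ _ hi]
    simp; omega
  face_face ε ε' i j := by
    rintro ⟨⟨g, m⟩, hm⟩ hij hj
    change j + 1 < m.length at hj
    change m.count true = P.dim g at hm
    obtain ⟨a, y, c, rfl, hj'⟩ := exists_split m (j + 1) hj
    obtain ⟨a, x, b, rfl, hi⟩ := exists_split a i (by omega)
    refine congrArg (Quot.mk DegenRel) (Subtype.ext ?_)
    change rawFace ε j (rawFace ε' i (g, a ++ x :: b ++ y :: c)) =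
      rawFace ε' i (rawFace ε (j + 1) (g, a ++ x :: b ++ y :: c))
    rw [rawFace_split ε _ _ _ _ _ hj', List.append_assoc, List.append_assoc, List.cons_append,
      List.cons_append, rawFace_split ε' _ _ _ _ _ hi, rawFace_split ε' _ _ _ _ _ hi,
      ← List.append_assoc, rawFace_split ε _ _ _ _ _ (by simp at hj' ⊢; omega), List.append_assoc]
    congr 1
    cases x <;> cases y <;> simp
    have := P.face_face ε ε' (a.count true) (a.count true + b.count true) g (by omega)
      (by simp at hm; omega)
    rw [this, add_assoc]
  face_degen_of_lt ε i j := by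
    rintro ⟨⟨g, m⟩, hm⟩ hij hj
    change j ≤ m.length at hj
    obtain ⟨a, c, rfl, hj'⟩ := exists_cut m j hj
    obtain ⟨a, x, b, rfl, hi⟩ := exists_split a i (by omega)
    refine congrArg (Quot.mk DegenRel) (Subtype.ext ?_)
    change rawFace ε i (rawDegen j (g, a ++ x :: b ++ c)) =
      rawDegen (j - 1) (rawFace ε i (g, a ++ x :: b ++ c))
    rw [rawDegen_split _ _ _ _ hj', List.append_assoc, List.append_assoc, List.cons_append,
      List.cons_append, rawFace_split ε _ _ _ _ _ hi, rawFace_split ε _ _ _ _ _ hi,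
      ← List.append_assoc, ← List.append_assoc, rawDegen_split _ _ _ _ (by simp at hj' ⊢; omega)]
  face_degen_self ε i := by
    rintro ⟨⟨g, m⟩, hm⟩ hi
    change i ≤ m.length at hi
    obtain ⟨a, c, rfl, hi'⟩ := exists_cut m i hi
    refine congrArg (Quot.mk DegenRel) (Subtype.ext ?_)
    change rawFace ε i (rawDegen i (g, a ++ c)) = (g, a ++ c)
    rw [rawDegen_split _ _ _ _ hi', rawFace_split ε _ _ _ _ _ hi']
    simp
  face_degen_of_gt ε i j := by
    rintro ⟨⟨g, m⟩, hm⟩ hij hi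
    change i ≤ m.length at hi
    obtain ⟨a, b, rfl, hj⟩ := exists_cut m j (by omega)
    obtain ⟨b, x, c, rfl, hi'⟩ := exists_split b (i - 1 - j) (by simp at hi; omega)
    refine congrArg (Quot.mk DegenRel) (Subtype.ext ?_)
    change rawFace ε i (rawDegen j (g, a ++ (b ++ x :: c))) =
      rawDegen j (rawFace ε (i - 1) (g, a ++ (b ++ x :: c)))
    rw [rawDegen_split _ _ _ _ hj, ← List.append_assoc, rawFace_split ε _ (i - 1) _ _ _
      (by simp; omega), ← List.cons_append, ← List.append_assoc, rawFace_split ε _ i _ _ _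
      (by simp; omega), List.append_assoc, List.append_assoc, rawDegen_split _ _ _ _ hj]
    simp
  degen_degen i j := by
    rintro ⟨⟨g, m⟩, hm⟩ hij hj
    change j ≤ m.length at hj
    obtain ⟨a, c, rfl, hj'⟩ := exists_cut m j hj
    obtain ⟨a, b, rfl, hi⟩ := exists_cut a i (by omega)
    refine congrArg (Quot.mk DegenRel) (Subtype.ext ?_)
    change rawDegen i (rawDegen j (g, a ++ b ++ c)) =
      rawDegen (j + 1) (rawDegen i (g, a ++ b ++ c))
    rw [rawDegen_split _ _ _ _ hj', List.append_assoc, List.append_assoc, rawDegen_split _ _ _ _ hi,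
      rawDegen_split _ _ _ _ hi, ← List.cons_append, ← List.append_assoc,
      ← List.cons_append, ← List.append_assoc,
      rawDegen_split (j + 1) _ _ _ (by simp at hj' ⊢; omega)]

/-- The element of the generated cubical set given by an element of `P`. -/
def cube (g : P.carrier) : P.toCubicalSet.carrier :=
  Quot.mk DegenRel ⟨(g, List.replicate (P.dim g) true), by simp⟩

end SemiCubicalSet

/-! ### The cubical loop set of a 1-reduced simplicial set -/

/-- Words in the letters `x̄`, for simplices `x` of dimension at least `2`.  For a 1-reduced `X` this
is the free monoid on the letters `x̄` with `dim x ≥ 1`, modulo the identification of the letter of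
the only 1-simplex with the unit. -/
abbrev LoopWord (X : SSet.{u}) : Type u := List {x : Simplex X // 2 ≤ x.dim}

namespace LoopWord

variable {X : SSet.{u}}

/-- The word `x̄` given by a simplex `x` of positive dimension; it is the unit if `dim x = 1`. -/
def bar (x : Simplex X) : LoopWord X := if h : 2 ≤ x.dim then [⟨x, h⟩] else []

/-- The degree of a word, where `x̄` has degree `dim x - 1`. -/
def dim : LoopWord X → ℕ
  | [] => 0
  | x :: w => (x.1.dim - 1) + dim w

/-- The face operators on a generator: `d_i^0 x̄ = x̄' · x̄''` for the front `i`-face `x'` and the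
complementary back face `x''` of `x`, and `d_i^1 x̄` is the word of `∂_i x`. -/
def letterFace (ε : Bool) (i : ℕ) (x : Simplex X) : LoopWord X :=
  if ε then bar (x.face (i + 1)) else bar (x.front (i + 1)) ++ bar (x.back (i + 1))

/-- The face operators on words. -/
def face (ε : Bool) : ℕ → LoopWord X → LoopWord X
  | _, [] => []
  | i, x :: w =>
    if i < x.1.dim - 1 then letterFace ε i x.1 ++ w else x :: face ε (i - (x.1.dim - 1)) w

@[simp] theorem dim_nil : dim ([] : LoopWord X) = 0 := rfl

@[simp] theorem dim_append (u v : LoopWord X) : dim (u ++ v) = dim u + dim v := by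
  induction u with
  | nil => simp
  | cons x u ih => simp only [List.cons_append, dim, ih]; omega

@[simp] theorem dim_bar (x : Simplex X) : dim (bar x) = x.dim - 1 := by
  unfold bar
  split_ifs
  · simp [dim]
  · simp; omega

theorem bar_of_le (x : Simplex X) (h : x.dim ≤ 1) : bar x = [] := by
  unfold bar
  rw [dif_neg (by omega)]

theorem dim_letterFace (ε : Bool) (i : ℕ) (x : Simplex X) (h : i < x.dim - 1) :
    dim (letterFace ε i x) + 1 = x.dim - 1 := by
  cases ε <;> simp [letterFace] <;> omega

theorem face_append_left (ε : Bool) (i : ℕ) (u v : LoopWord X) (h : i < dim u) :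
    face ε i (u ++ v) = face ε i u ++ v := by
  induction u generalizing i with
  | nil => simp at h
  | cons x u ih =>
    simp only [dim] at h
    simp only [List.cons_append, face]
    split_ifs with h1
    · simp
    · simp [ih (i - (x.1.dim - 1)) (by omega)]

theorem face_append_right (ε : Bool) (i j : ℕ) (u v : LoopWord X) (h : i = dim u + j) :
    face ε i (u ++ v) = u ++ face ε j v := by
  induction u generalizing i with
  | nil => simp at h; simp [h]
  | cons x u ih =>
    simp only [dim] at h
    simp only [List.cons_append, face]
    rw [if_neg (by omega), ih (i - (x.1.dim - 1)) (by omega)]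

theorem face_bar (ε : Bool) (i : ℕ) (x : Simplex X) (h : i < x.dim - 1) :
    face ε i (bar x) = letterFace ε i x := by
  unfold bar
  rw [dif_pos (by omega)]
  simp [face, h]

theorem dim_wordFace (ε : Bool) (i : ℕ) (w : LoopWord X) (h : i < dim w) :
    dim (face ε i w) + 1 = dim w := by
  induction w generalizing i with
  | nil => simp at h
  | cons x w ih =>
    simp only [dim] at h
    simp only [face]
    split_ifs with h1
    · have := dim_letterFace ε i x.1 h1
      simp only [dim_append, dim]; omega
    · have := ih (i - (x.1.dim - 1)) (by omega)
      simp only [dim]; omega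

theorem face_letterFace (ε ε' : Bool) (i j : ℕ) (x : Simplex X) (hij : i ≤ j)
    (hj : j + 1 < x.dim - 1) :
    face ε j (letterFace ε' i x) = face ε' i (letterFace ε (j + 1) x) := by
  cases ε'
  · have e : face ε j (letterFace false i x) =
        bar (x.front (i + 1)) ++ letterFace ε (j - i) (x.back (i + 1)) := by
      simp only [letterFace, Bool.false_eq_true, if_false]
      rw [face_append_right ε j (j - i) _ _ (by simp; omega), face_bar _ _ _ (by simp; omega)]
      rfl
    rw [e]
    cases ε
    · simp only [letterFace, Bool.false_eq_true, if_false]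
      rw [face_append_left _ _ _ _ (by simp; omega), face_bar _ _ _ (by simp; omega)]
      simp only [letterFace, Bool.false_eq_true, if_false]
      rw [Simplex.front_front _ _ _ (by omega), Simplex.back_front _ _ _ (by omega),
        Simplex.back_back _ _ _ (by omega), List.append_assoc]
      congr 4 <;> omega
    · simp only [letterFace, if_true]
      rw [face_bar _ _ _ (by simp; omega)]
      simp only [letterFace, Bool.false_eq_true, if_false]
      rw [Simplex.front_face_of_lt _ _ _ (by omega) (by omega),
        Simplex.back_face_of_ge _ _ _ (by omega) (by omega)]
      congr 3; omega
  · cases ε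
    · simp only [letterFace, Bool.false_eq_true, if_false, if_true]
      rw [face_bar _ _ _ (by simp; omega), face_append_left _ _ _ _ (by simp; omega),
        face_bar _ _ _ (by simp; omega)]
      simp only [letterFace, Bool.false_eq_true, if_false, if_true]
      rw [Simplex.front_face_of_le _ _ _ (by omega) (by omega),
        Simplex.back_face_of_le _ _ _ (by omega) (by omega)]
    · simp only [letterFace, if_true]
      rw [face_bar _ _ _ (by simp; omega), face_bar _ _ _ (by simp; omega)]
      simp only [letterFace, if_true]
      rw [Simplex.face_face _ _ _ (by omega) (by omega) (by omega)]

theorem face_face (ε ε' : Bool) (i j : ℕ) (w : LoopWord X) (hij : i ≤ j) (hj : j + 1 < dim w) :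
    face ε j (face ε' i w) = face ε' i (face ε (j + 1) w) := by
  induction w generalizing i j with
  | nil => simp at hj
  | cons x w ih =>
    simp only [dim] at hj
    rcases lt_or_ge (j + 1) (x.1.dim - 1) with h | h
    · have h1 := dim_letterFace ε' i x.1 (by omega)
      have h2 := dim_letterFace ε (j + 1) x.1 (by omega)
      simp only [face]
      rw [if_pos (by omega), if_pos h, face_append_left _ _ _ _ (by omega),
        face_append_left _ _ _ _ (by omega), face_letterFace _ _ _ _ _ hij h]
    · rcases lt_or_ge i (x.1.dim - 1) with h' | h'
      · have h1 := dim_letterFace ε' i x.1 h'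
        simp only [face]
        rw [if_pos h', if_neg (by omega), face_append_right _ _ (j + 1 - (x.1.dim - 1)) _ _
          (by omega)]
        simp [face, h']
      · simp only [face]
        rw [if_neg (by omega), if_neg (by omega)]
        simp only [face]
        rw [if_neg (by omega), if_neg (by omega), ih _ _ (by omega) (by omega)]
        congr 3; omega

/-- The last degeneracy `s_n x̄` of an `n`-simplex `x` (`n ≥ 1`) is the degeneracy `η_n x̄` of `x̄`, at
each place of a word. -/
inductive IsDegen : ℕ → LoopWord X → LoopWord X → Prop where
  | mk (u v : LoopWord X) (x : Simplex X) (hx : 1 ≤ x.dim) :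
      IsDegen (dim u + (x.dim - 1)) (u ++ (bar (x.degen x.dim) ++ v)) (u ++ (bar x ++ v))

theorem IsDegen.of_eq {k : ℕ} {g h : LoopWord X} (u v : LoopWord X) (x : Simplex X)
    (hx : 1 ≤ x.dim) (hk : k = dim u + (x.dim - 1)) (hg : g = u ++ (bar (x.degen x.dim) ++ v))
    (hh : h = u ++ (bar x ++ v)) : IsDegen k g h := by
  subst hk hg hh
  exact .mk u v x hx

variable (X) in
/-- The monoid of words as a cubical set without degeneracies, with the prescribed degeneracies. -/
def toSemiCubicalSet : SemiCubicalSet.{u} where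
  carrier := LoopWord X
  dim := dim
  face := face
  dim_face ε i x := dim_wordFace ε i x
  face_face ε ε' i j x := face_face ε ε' i j x
  IsDegen := IsDegen
  dim_of_isDegen := by
    rintro k g h ⟨u, v, x, hx⟩
    simp; omega
  face_of_isDegen_lt := by
    rintro ε i k g h ⟨u, v, x, hx⟩ hi -
    rcases lt_or_ge i (dim u) with hu | hu
    · have := dim_wordFace ε i u hu
      rw [face_append_left _ _ _ _ hu, face_append_left _ _ _ _ hu]
      exact .of_eq (face ε i u) v x hx (by omega) rfl rfl
    · have e : i = dim u + (i - dim u) := by omega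
      rw [face_append_right _ _ _ _ _ e, face_append_right _ _ _ _ _ e,
        face_append_left _ _ _ _ (by simp; omega), face_append_left _ _ _ _ (by simp; omega),
        face_bar _ _ _ (by simp; omega), face_bar _ _ _ (by omega)]
      cases ε
      · simp only [letterFace, Bool.false_eq_true, if_false]
        rw [Simplex.front_degen _ _ (by omega), Simplex.back_degen _ _ (by omega)]
        exact .of_eq (u ++ bar (x.front (i - dim u + 1))) v (x.back (i - dim u + 1))
          (by simp; omega) (by simp; omega) (by simp) (by simp)
      · simp only [letterFace, if_true]
        rw [Simplex.face_degen_of_lt _ _ (by omega)]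
        exact .of_eq u v (x.face (i - dim u + 1)) (by simp; omega) (by simp; omega) rfl rfl
  face_of_isDegen_self := by
    rintro ε k g h ⟨u, v, x, hx⟩ -
    rw [face_append_right _ _ _ _ _ rfl, face_append_left _ _ _ _ (by simp; omega),
      face_bar _ _ _ (by simp; omega)]
    congr 2
    have e : x.dim - 1 + 1 = x.dim := by omega
    cases ε
    · simp only [letterFace, Bool.false_eq_true, if_false, e]
      rw [Simplex.front_degen _ _ le_rfl, Simplex.front_self, bar_of_le (Simplex.back _ _)
        (by simp), List.append_nil]
    · simp only [letterFace, if_true, e]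
      rw [Simplex.face_degen_self _ _ le_rfl]
  face_of_isDegen_gt := by
    rintro ε i k g h ⟨u, v, x, hx⟩ hi -
    rw [face_append_right _ i (i - dim u) _ _ (by omega),
      face_append_right _ (i - dim u) (i - dim u - x.dim) _ _ (by simp; omega),
      face_append_right _ (i - 1) (i - 1 - dim u) _ _ (by omega),
      face_append_right _ (i - 1 - dim u) (i - dim u - x.dim) _ _ (by simp; omega)]
    exact .mk u _ x hx

/-- Concatenation of words. -/
def conc (u v : (toSemiCubicalSet X).carrier) : (toSemiCubicalSet X).carrier :=
  (show LoopWord X from u) ++ (show LoopWord X from v)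

theorem dim_conc (u v : (toSemiCubicalSet X).carrier) : (toSemiCubicalSet X).dim (conc u v) =
    (toSemiCubicalSet X).dim u + (toSemiCubicalSet X).dim v :=
  dim_append _ _

theorem conc_assoc (u v w : (toSemiCubicalSet X).carrier) :
    conc (conc u v) w = conc u (conc v w) :=
  List.append_assoc _ _ _

theorem conc_nil (u : (toSemiCubicalSet X).carrier) : conc u ([] : LoopWord X) = u :=
  List.append_nil _

theorem face_conc_left (ε : Bool) (i : ℕ) (u v : (toSemiCubicalSet X).carrier)
    (h : i < (toSemiCubicalSet X).dim u) :
    (toSemiCubicalSet X).face ε i (conc u v) = conc ((toSemiCubicalSet X).face ε i u) v :=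
  face_append_left ε i _ _ h

theorem face_conc_right (ε : Bool) (i : ℕ) (u v : (toSemiCubicalSet X).carrier) :
    (toSemiCubicalSet X).face ε ((toSemiCubicalSet X).dim u + i) (conc u v) =
      conc u ((toSemiCubicalSet X).face ε i v) :=
  face_append_right ε _ i _ _ rfl

theorem isDegen_conc_right (k : ℕ) (g h u : (toSemiCubicalSet X).carrier)
    (hd : (toSemiCubicalSet X).IsDegen k g h) :
    (toSemiCubicalSet X).IsDegen ((toSemiCubicalSet X).dim u + k) (conc u g) (conc u h) := by
  obtain ⟨a, b, x, hx⟩ := hd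
  exact .of_eq (conc u a) b x hx ((add_assoc _ _ _).symm.trans
    (congrArg (· + (x.dim - 1)) (dim_conc _ _).symm)) (List.append_assoc _ _ _).symm
    (List.append_assoc _ _ _).symm

theorem isDegen_conc_left (k : ℕ) (g h u : (toSemiCubicalSet X).carrier)
    (hd : (toSemiCubicalSet X).IsDegen k g h) :
    (toSemiCubicalSet X).IsDegen k (conc g u) (conc h u) := by
  obtain ⟨a, b, x, hx⟩ := hd
  exact .of_eq a (conc b u) x hx rfl
    ((List.append_assoc _ _ _).trans (congrArg (a ++ ·) (List.append_assoc _ _ _)))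
    ((List.append_assoc _ _ _).trans (congrArg (a ++ ·) (List.append_assoc _ _ _)))

end LoopWord

namespace LoopSet

open SemiCubicalSet LoopWord

variable {X : SSet.{u}}

/-- Concatenation of formal degeneracies of words. -/
def formalMul (p q : (toSemiCubicalSet X).Formal) : (toSemiCubicalSet X).Formal :=
  ⟨(conc p.1.1 q.1.1, p.1.2 ++ q.1.2), by rw [dim_conc, List.count_append, p.2, q.2]⟩

theorem formalMul_rel_right (p q q' : (toSemiCubicalSet X).Formal)
    (h : DegenRel q q') : DegenRel (formalMul p q) (formalMul p q') := by
  obtain ⟨g, h, a, b, hd, hg, hh⟩ := h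
  refine .of_eq (conc p.1.1 g) (conc p.1.1 h) (p.1.2 ++ a) b ?_
    (by simp [formalMul]) (by simp [formalMul])
  rw [List.count_append, p.2]
  exact isDegen_conc_right _ _ _ _ hd

theorem formalMul_rel_left (p p' q : (toSemiCubicalSet X).Formal)
    (h : DegenRel p p') : DegenRel (formalMul p q) (formalMul p' q) := by
  obtain ⟨g, h, a, b, hd, hg, hh⟩ := h
  exact .of_eq (conc g q.1.1) (conc h q.1.1) a (b ++ q.1.2) (isDegen_conc_left _ _ _ _ hd)
    (by simp [formalMul]) (by simp [formalMul])

end LoopSet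

open SemiCubicalSet LoopWord in
/-- The monoidal cubical set `𝛀X` of a 1-reduced simplicial set `X`: formal degeneracies of words,
with `η_n x̄` identified with the letter of `s_n x` for `x ∈ X_n`, `n ≥ 1`. -/
def cubicalLoops (X : SSet.{u}) : MonoidalCubicalSet.{u} where
  toCubicalSet := (toSemiCubicalSet X).toCubicalSet
  one := Quot.mk _ ⟨(([] : LoopWord X), []), rfl⟩
  mul := Quot.map₂ LoopSet.formalMul LoopSet.formalMul_rel_right LoopSet.formalMul_rel_left
  dim_one := rfl
  dim_mul := by
    rintro ⟨p⟩ ⟨q⟩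
    exact List.length_append
  one_mul := by
    rintro ⟨⟨⟨w, m⟩, hm⟩⟩
    rfl
  mul_one := by
    rintro ⟨⟨⟨w, m⟩, hm⟩⟩
    exact congrArg (Quot.mk _) (Subtype.ext (Prod.ext (conc_nil w) (List.append_nil m)))
  mul_assoc := by
    rintro ⟨p⟩ ⟨q⟩ ⟨r⟩
    exact congrArg (Quot.mk _) (Subtype.ext (Prod.ext (conc_assoc _ _ _)
      (List.append_assoc _ _ _)))
  face_mul_left := by
    rintro ε i ⟨⟨⟨v, m⟩, hm⟩⟩ ⟨⟨⟨w, m'⟩, hm'⟩⟩ hi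
    obtain ⟨a, x, b, rfl, hi'⟩ := exists_split m i hi
    refine congrArg (Quot.mk _) (Subtype.ext ?_)
    change rawFace ε i (conc v w, (a ++ x :: b) ++ m') =
      (conc (rawFace ε i (v, a ++ x :: b)).1 w, (rawFace ε i (v, a ++ x :: b)).2 ++ m')
    rw [rawFace_split _ _ _ _ _ _ hi', List.append_assoc, List.cons_append,
      rawFace_split _ _ _ _ _ _ hi']
    cases x
    · simp
    · have := face_conc_left ε (a.count true) v w (by rw [← hm]; simp)
      simp [this]
  face_mul_right := by
    rintro ε i ⟨⟨⟨v, m⟩, hm⟩⟩ ⟨⟨⟨w, m'⟩, hm'⟩⟩ hi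
    obtain ⟨a, x, b, rfl, hi'⟩ := exists_split m' i hi
    refine congrArg (Quot.mk _) (Subtype.ext ?_)
    change rawFace ε (m.length + i) (conc v w, m ++ (a ++ x :: b)) =
      (conc v (rawFace ε i (w, a ++ x :: b)).1, m ++ (rawFace ε i (w, a ++ x :: b)).2)
    rw [rawFace_split _ _ _ _ _ _ hi', ← List.append_assoc,
      rawFace_split _ _ _ _ _ _ (by simp; omega)]
    cases x
    · simp
    · have := face_conc_right ε (a.count true) v w
      rw [← hm] at this
      simpa using this
  degen_mul_left := by
    rintro i ⟨⟨⟨v, m⟩, hm⟩⟩ ⟨⟨⟨w, m'⟩, hm'⟩⟩ hi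
    obtain ⟨a, b, rfl, hi'⟩ := exists_cut m i hi
    refine congrArg (Quot.mk _) (Subtype.ext ?_)
    change rawDegen i (conc v w, (a ++ b) ++ m') =
      (conc v w, (rawDegen i (v, a ++ b)).2 ++ m')
    rw [rawDegen_split _ _ _ _ hi', List.append_assoc, rawDegen_split _ _ _ _ hi']
    simp
  degen_mul_right := by
    rintro i ⟨⟨⟨v, m⟩, hm⟩⟩ ⟨⟨⟨w, m'⟩, hm'⟩⟩ hi
    obtain ⟨a, b, rfl, hi'⟩ := exists_cut m' i hi
    refine congrArg (Quot.mk _) (Subtype.ext ?_)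
    change rawDegen (m.length + i) (conc v w, m ++ (a ++ b)) =
      (conc v w, m ++ (rawDegen i (w, a ++ b)).2)
    rw [rawDegen_split _ _ _ _ hi', ← List.append_assoc,
      rawDegen_split _ _ _ _ (by simp; omega)]
    simp

/-! ### Truncating twisting functions and twisted Cartesian products -/

/-- Truncating twisting functions `τ_n : X_n → Q_{n-1}`, `n ≥ 1`, from a simplicial set to a monoidal
cubical set.  (The values on 0-simplices carry no meaning.) -/
structure TruncatingTwistingFunction (X : SSet.{u}) (Q : MonoidalCubicalSet.{v}) where
  toFun : Simplex X → Q.carrier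
  dim_toFun : ∀ x, 1 ≤ x.dim → Q.dim (toFun x) + 1 = x.dim
  toFun_one : ∀ x, x.dim = 1 → toFun x = Q.one
  face_false : ∀ i x, i + 1 < x.dim →
    Q.face false i (toFun x) = Q.mul (toFun (x.front (i + 1))) (toFun (x.back (i + 1)))
  face_true : ∀ i x, i + 1 < x.dim → Q.face true i (toFun x) = toFun (x.face (i + 1))
  degen_last : ∀ x, 1 ≤ x.dim → Q.degen (x.dim - 1) (toFun x) = toFun (x.degen x.dim)

open SemiCubicalSet LoopWord in
/-- The universal truncating twisting function `X → 𝛀X`, `x ↦ x̄`. -/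
def universalTwistingFunction (X : SSet.{u}) :
    TruncatingTwistingFunction X (cubicalLoops X) where
  toFun x := cube (P := toSemiCubicalSet X) (bar x)
  dim_toFun x hx := by
    change (List.replicate (LoopWord.dim (bar x)) true).length + 1 = x.dim
    rw [List.length_replicate, dim_bar]; omega
  toFun_one x hx := by
    refine congrArg (Quot.mk _) (Subtype.ext (Prod.ext (bar_of_le x hx.le) ?_))
    change List.replicate (LoopWord.dim (bar x)) true = []
    rw [dim_bar, hx]; rfl
  face_false i x hi := by
    refine congrArg (Quot.mk _) (Subtype.ext ?_)
    change rawFace (P := toSemiCubicalSet X) false i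
      (bar x, List.replicate (LoopWord.dim (bar x)) true) =
      (conc (bar (x.front (i + 1))) (bar (x.back (i + 1))),
        List.replicate (LoopWord.dim (bar (x.front (i + 1)))) true ++
        List.replicate (LoopWord.dim (bar (x.back (i + 1)))) true)
    have e : List.replicate (LoopWord.dim (bar x)) true =
        List.replicate i true ++ true :: List.replicate (x.dim - 2 - i) true := by
      rw [← List.replicate_succ, List.replicate_append_replicate, dim_bar]; congr 1; omega
    have e2 : (toSemiCubicalSet X).face false i (bar x) =
        conc (bar (x.front (i + 1))) (bar (x.back (i + 1))) :=
      LoopWord.face_bar false i x (by omega)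
    rw [e, dim_bar, dim_bar]
    refine (rawFace_split (P := toSemiCubicalSet X) false true i (bar x) _ _ (by simp)).trans ?_
    refine Prod.ext ?_ ?_
    · rw [List.count_replicate_self]; exact e2
    · simp; omega
  face_true i x hi := by
    refine congrArg (Quot.mk _) (Subtype.ext ?_)
    change rawFace (P := toSemiCubicalSet X) true i
      (bar x, List.replicate (LoopWord.dim (bar x)) true) =
      (bar (x.face (i + 1)), List.replicate (LoopWord.dim (bar (x.face (i + 1)))) true)
    have e : List.replicate (LoopWord.dim (bar x)) true =
        List.replicate i true ++ true :: List.replicate (x.dim - 2 - i) true := by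
      rw [← List.replicate_succ, List.replicate_append_replicate, dim_bar]; congr 1; omega
    have e2 : (toSemiCubicalSet X).face true i (bar x) = bar (x.face (i + 1)) :=
      LoopWord.face_bar true i x (by omega)
    rw [e, dim_bar]
    refine (rawFace_split (P := toSemiCubicalSet X) true true i (bar x) _ _ (by simp)).trans ?_
    refine Prod.ext ?_ ?_
    · rw [List.count_replicate_self]; exact e2
    · simp; omega
  degen_last x hx := by
    refine (Quot.sound ?_).symm
    have e1 : List.replicate (LoopWord.dim (bar (x.degen x.dim))) true =
        List.replicate (x.dim - 1) true ++ true :: [] := by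
      rw [dim_bar, Simplex.dim_degen, show x.dim + 1 - 1 = x.dim - 1 + 1 by omega,
        List.replicate_succ']
    refine .of_eq (bar (x.degen x.dim)) (bar x) (List.replicate (x.dim - 1) true) [] ?_ ?_ ?_
    · exact .of_eq [] [] x hx (by simp) (by simp) (by simp)
    · exact Prod.ext rfl e1
    · change rawDegen (P := toSemiCubicalSet X) (x.dim - 1)
        (bar x, List.replicate (LoopWord.dim (bar x)) true) = _
      rw [dim_bar]
      exact rawDegen_of_le (P := toSemiCubicalSet X) _ (bar x) _ (by simp)

namespace TwistedProduct

open SemiCubicalSet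

variable {X : SSet.{u}} {Q : MonoidalCubicalSet.{v}}
  (τ : TruncatingTwistingFunction X Q) (L : CubicalModule.{v, w} Q)

/-- The face operators on pairs `(x, y)`: for `i ≤ p = dim x`, `d_i^0 (x, y) = (x', τ(x'') · y)` with
the front face `x' = ∂_i ⋯ ∂_p x` and the back face `x'' = ∂_0 ⋯ ∂_{i-2} x`, and
`d_i^1 (x, y) = (∂_{i-1} x, y)`; for `i > p`, `d_i^ε (x, y) = (x, d_{i-p}^ε y)`. -/
def pairFace (ε : Bool) (i : ℕ) (z : Simplex X × L.carrier) : Simplex X × L.carrier :=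
  if i < z.1.dim then
    if ε then (z.1.face i, z.2) else (z.1.front i, L.act (τ.toFun (z.1.back i)) z.2)
  else (z.1, L.face ε (i - z.1.dim) z.2)

/-- The degenerate pairs: `(x, η_{j+1} y)` is the degeneracy number `p + j + 1` of `(x, y)`, and
`(s_p x, y)` is the degeneracy number `p + 1` of `(x, y)`, for `p = dim x`. -/
inductive PairIsDegen : ℕ → Simplex X × L.carrier → Simplex X × L.carrier → Prop where
  | right (x : Simplex X) (y : L.carrier) (j : ℕ) (hj : j ≤ L.dim y) :
      PairIsDegen (x.dim + j) (x, L.degen j y) (x, y)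
  | left (x : Simplex X) (y : L.carrier) :
      PairIsDegen x.dim (x.degen x.dim, y) (x, y)

theorem PairIsDegen.of_right {k : ℕ} {g h : Simplex X × L.carrier} (x : Simplex X) (y : L.carrier)
    (j : ℕ) (hj : j ≤ L.dim y) (hk : k = x.dim + j) (hg : g = (x, L.degen j y)) (hh : h = (x, y)) :
    PairIsDegen L k g h := by
  subst hk hg hh
  exact .right x y j hj

theorem PairIsDegen.of_left {k : ℕ} {g h : Simplex X × L.carrier} (x : Simplex X) (y : L.carrier)
    (hk : k = x.dim) (hg : g = (x.degen x.dim, y)) (hh : h = (x, y)) :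
    PairIsDegen L k g h := by
  subst hk hg hh
  exact .left x y

theorem pairFace_right (ε : Bool) (i j : ℕ) (x : Simplex X) (y : L.carrier)
    (h : i = x.dim + j) : pairFace τ L ε i (x, y) = (x, L.face ε j y) := by
  subst h
  simp [pairFace]

theorem pairFace_true (i : ℕ) (x : Simplex X) (y : L.carrier) (h : i < x.dim) :
    pairFace τ L true i (x, y) = (x.face i, y) := by
  simp [pairFace, h]

theorem pairFace_false (i : ℕ) (x : Simplex X) (y : L.carrier) (h : i < x.dim) :
    pairFace τ L false i (x, y) = (x.front i, L.act (τ.toFun (x.back i)) y) := by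
  simp [pairFace, h]

theorem dim_toFun_back (i : ℕ) (x : Simplex X) (h : i < x.dim) :
    Q.dim (τ.toFun (x.back i)) = x.dim - i - 1 := by
  have := τ.dim_toFun (x.back i) (by simp; omega)
  simp at this
  omega

theorem pairFace_pairFace (ε ε' : Bool) (i j : ℕ) (z : Simplex X × L.carrier) (hij : i ≤ j)
    (hj : j + 1 < z.1.dim + L.dim z.2) :
    pairFace τ L ε j (pairFace τ L ε' i z) = pairFace τ L ε' i (pairFace τ L ε (j + 1) z) := by
  obtain ⟨x, y⟩ := z
  simp only at hj
  rcases lt_or_ge (j + 1) x.dim with h | h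
  · have hd := dim_toFun_back τ i x (by omega)
    have e1 : i + (j - i + 1) = j + 1 := by omega
    have e2 : j + 1 - i = j - i + 1 := by omega
    cases ε'
    · rw [pairFace_false τ L i x y (by omega), pairFace_right τ L ε j (j - i) _ _ (by simp; omega),
        L.face_act_left _ _ _ _ (by omega)]
      cases ε
      · rw [pairFace_false τ L (j + 1) x y h, pairFace_false τ L i _ _ (by simp; omega),
          τ.face_false _ _ (by simp; omega), L.mul_act, Simplex.front_front _ _ _ (by omega),
          Simplex.back_front _ _ _ (by omega), Simplex.back_back _ _ _ (by omega), e1, e2]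
      · rw [pairFace_true τ L (j + 1) x y h, pairFace_false τ L i _ _ (by simp; omega),
          τ.face_true _ _ (by simp; omega), Simplex.front_face_of_lt _ _ _ (by omega) (by omega),
          Simplex.back_face_of_ge _ _ _ (by omega) (by omega), e2]
    · rw [pairFace_true τ L i x y (by omega)]
      cases ε
      · rw [pairFace_false τ L (j + 1) x y h, pairFace_false τ L j _ _ (by simp; omega),
          pairFace_true τ L i _ _ (by simp; omega),
          Simplex.front_face_of_le _ _ _ (by omega) (by omega),
          Simplex.back_face_of_le _ _ _ (by omega) (by omega)]
      · rw [pairFace_true τ L (j + 1) x y h, pairFace_true τ L j _ _ (by simp; omega),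
          pairFace_true τ L i _ _ (by simp; omega),
          Simplex.face_face _ _ _ (by omega) (by omega) (by omega)]
  · rw [pairFace_right τ L ε (j + 1) (j + 1 - x.dim) x y (by omega)]
    rcases lt_or_ge i x.dim with h' | h'
    · have hd := dim_toFun_back τ i x (by omega)
      cases ε'
      · rw [pairFace_false τ L i x y (by omega), pairFace_false τ L i x _ (by omega),
          pairFace_right τ L ε j (j - i) _ _ (by simp; omega),
          show j - i = Q.dim (τ.toFun (x.back i)) + (j + 1 - x.dim) by omega,
          L.face_act_right _ _ _ _ (by omega)]
      · rw [pairFace_true τ L i x y (by omega), pairFace_true τ L i x _ (by omega),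
          pairFace_right τ L ε j (j + 1 - x.dim) _ _ (by simp; omega)]
    · rw [pairFace_right τ L ε' i (i - x.dim) x y (by omega),
        pairFace_right τ L ε' i (i - x.dim) x _ (by omega),
        pairFace_right τ L ε j (j - x.dim) x _ (by omega),
        L.face_face _ _ _ _ _ (by omega) (by omega),
        show j - x.dim + 1 = j + 1 - x.dim by omega]

/-- The pairs `(x, y)` as a cubical set without degeneracies, with the degenerate pairs. -/
def toSemiCubicalSet : SemiCubicalSet.{max u w} where
  carrier := Simplex X × L.carrier
  dim z := z.1.dim + L.dim z.2
  face := pairFace τ L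
  dim_face := by
    rintro ε i ⟨x, y⟩ hi
    simp only at hi
    rcases lt_or_ge i x.dim with h | h
    · cases ε
      · rw [pairFace_false τ L i x y h]
        have := dim_toFun_back τ i x h
        simp only [Simplex.dim_front, L.dim_act]; omega
      · rw [pairFace_true τ L i x y h]
        simp only [Simplex.dim_face]; omega
    · rw [pairFace_right τ L ε i (i - x.dim) x y (by omega)]
      have := L.dim_face ε (i - x.dim) y (by omega)
      simp only; omega
  face_face ε ε' i j z hij hj := pairFace_pairFace τ L ε ε' i j z hij hj
  IsDegen := PairIsDegen L
  dim_of_isDegen := by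
    rintro k g h (⟨x, y, j, hj⟩ | ⟨x, y⟩)
    · simp only [L.dim_degen _ _ hj]; omega
    · simp only [Simplex.dim_degen]; omega
  face_of_isDegen_lt := by
    rintro ε i k g h (⟨x, y, j, hj⟩ | ⟨x, y⟩) hi -
    · rcases lt_or_ge i x.dim with h | h
      · cases ε
        · have hd := dim_toFun_back τ i x h
          rw [pairFace_false τ L i x _ h, pairFace_false τ L i x _ h,
            ← L.degen_act_right _ _ _ hj]
          exact .of_right L _ _ _ (by rw [L.dim_act]; omega) (by simp; omega) rfl rfl
        · rw [pairFace_true τ L i x _ h, pairFace_true τ L i x _ h]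
          exact .of_right L _ _ j hj (by simp; omega) rfl rfl
      · have := L.dim_face ε (i - x.dim) y (by omega)
        rw [pairFace_right τ L ε i (i - x.dim) x _ (by omega),
          pairFace_right τ L ε i (i - x.dim) x _ (by omega),
          L.face_degen_of_lt _ _ _ _ (by omega) hj]
        exact .of_right L _ _ (j - 1) (by omega) (by omega) rfl rfl
    · cases ε
      · have hd := dim_toFun_back τ i x hi
        have := τ.degen_last (x.back i) (by simp; omega)
        rw [Simplex.dim_back] at this
        rw [pairFace_false τ L i _ _ (by simp; omega), pairFace_false τ L i x _ hi,
          Simplex.front_degen _ _ hi.le, Simplex.back_degen _ _ hi.le, ← this,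
          ← L.degen_act_left _ _ _ (by simp; omega)]
        exact .of_right L _ _ _ (by rw [L.dim_act]; simp; omega) (by simp; omega) rfl rfl
      · rw [pairFace_true τ L i _ _ (by simp; omega), pairFace_true τ L i x _ hi,
          Simplex.face_degen_of_lt _ _ hi]
        exact .of_left L _ _ (by simp) rfl rfl
  face_of_isDegen_self := by
    rintro ε k g h (⟨x, y, j, hj⟩ | ⟨x, y⟩) -
    · rw [pairFace_right τ L ε _ j x _ rfl, L.face_degen_self _ _ _ hj]
    · cases ε
      · rw [pairFace_false τ L _ _ _ (by simp), Simplex.front_degen _ _ le_rfl, Simplex.front_self,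
          τ.toFun_one _ (by simp), L.one_act]
      · rw [pairFace_true τ L _ _ _ (by simp), Simplex.face_degen_self _ _ le_rfl]
  face_of_isDegen_gt := by
    rintro ε i k g h (⟨x, y, j, hj⟩ | ⟨x, y⟩) hi hi'
    · simp only at hi'
      have := L.dim_face ε (i - 1 - x.dim) y (by omega)
      rw [pairFace_right τ L ε i (i - x.dim) x _ (by omega),
        pairFace_right τ L ε (i - 1) (i - 1 - x.dim) x _ (by omega),
        L.face_degen_of_gt _ _ _ _ (by omega) (by omega),
        show i - x.dim - 1 = i - 1 - x.dim by omega]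
      exact .of_right L _ _ j (by omega) rfl rfl rfl
    · simp only at hi'
      rw [pairFace_right τ L ε i (i - 1 - x.dim) _ _ (by simp; omega),
        pairFace_right τ L ε (i - 1) (i - 1 - x.dim) x _ (by omega)]
      exact .left x _

end TwistedProduct

/-- The twisted Cartesian product `X ×_τ L`: formal degeneracies of pairs `(x, y)`, modulo the
relations `(η_{p+1} x, y) ∼ (x, η_1 y)` and `(s_p x, y) ∼ (η_{p+1} x, y)` for `p = dim x`. -/
def twistedProduct {X : SSet.{u}} {Q : MonoidalCubicalSet.{v}}
    (τ : TruncatingTwistingFunction X Q) (L : CubicalModule.{v, w} Q) : CubicalSet.{max u w} :=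
  (TwistedProduct.toSemiCubicalSet τ L).toCubicalSet

/-- The element of `X ×_τ L` given by a simplex `x` and an element `y` of `L`. -/
def twistedProduct.pair {X : SSet.{u}} {Q : MonoidalCubicalSet.{v}}
    (τ : TruncatingTwistingFunction X Q) (L : CubicalModule.{v, w} Q)
    (x : Simplex X) (y : L.carrier) : (twistedProduct τ L).carrier :=
  SemiCubicalSet.cube (P := TwistedProduct.toSemiCubicalSet τ L) (x, y)

/-- The cubical path set `𝐏X`: the twisted Cartesian product of `X` and `𝛀X` with respect to the
universal truncating twisting function. -/
def cubicalPaths (X : SSet.{u}) : CubicalSet.{u} :=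
  twistedProduct (universalTwistingFunction X) (cubicalLoops X).selfModule

/-! ### Chain complexes -/

/-- A module with a family of submodules `gr n` (its elements of degree `n`) and an endomorphism `d`. -/
structure DGModule (R : Type t) [CommRing R] where
  carrier : Type v
  [addCommGroup : AddCommGroup carrier]
  [module : Module R carrier]
  gr : ℕ → Submodule R carrier
  d : carrier →ₗ[R] carrier

attribute [instance] DGModule.addCommGroup DGModule.module

namespace DGModule

variable {R : Type t} [CommRing R]

/-- `C` is a chain complex: it is the direct sum of the modules `gr n`, for `n ≥ 0`, and `d` is a
differential of degree `-1`. -/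
structure IsChainComplex (C : DGModule.{v, t} R) : Prop where
  isInternal : DirectSum.IsInternal C.gr
  d_mem : ∀ n, ∀ c ∈ C.gr (n + 1), C.d c ∈ C.gr n
  d_eq_zero : ∀ c ∈ C.gr 0, C.d c = 0
  d_d : ∀ c, C.d (C.d c) = 0

/-- A linear isomorphism is an isomorphism of chain complexes if it respects degrees and
differentials. -/
def IsIso {C : DGModule.{v, t} R} {D : DGModule.{w, t} R} (f : C.carrier ≃ₗ[R] D.carrier) : Prop :=
  (∀ n, (C.gr n).map f.toLinearMap = D.gr n) ∧ ∀ c, f (C.d c) = D.d (f c)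

end DGModule

/-! ### Normalized chains -/

/-- The free module on `S` modulo the elements of `Z ⊆ S`. -/
abbrev NormalizedChains (R : Type t) [CommRing R] {S : Type v} (Z : Set S) : Type (max v t) :=
  (S →₀ R) ⧸ Submodule.span R ((fun s => Finsupp.single s (1 : R)) '' Z)

namespace NormalizedChains

variable (R : Type t) [CommRing R] {S : Type v} (Z : Set S)

/-- The class of an element of `S`. -/
def mk (s : S) : NormalizedChains R Z := Submodule.Quotient.mk (Finsupp.single s 1)

variable {R Z}

theorem mk_eq_zero (s : S) (hs : s ∈ Z) : mk R Z s = 0 :=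
  (Submodule.Quotient.mk_eq_zero _).2 (Submodule.subset_span ⟨s, hs, rfl⟩)

/-- The linear map with prescribed values on `S`, which vanish on `Z`. -/
def lift {M : Type w} [AddCommGroup M] [Module R M] (F : S → M) (hF : ∀ s ∈ Z, F s = 0) :
    NormalizedChains R Z →ₗ[R] M :=
  Submodule.liftQ _ (Finsupp.lift M R S F) (by
    rw [Submodule.span_le]
    rintro _ ⟨s, hs, rfl⟩
    simp [hF s hs])

theorem lift_mk {M : Type w} [AddCommGroup M] [Module R M] (F : S → M) (hF : ∀ s ∈ Z, F s = 0)
    (s : S) : lift F hF (mk R Z s) = F s := by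
  change Finsupp.lift M R S F (Finsupp.single s 1) = F s
  simp

theorem hom_ext {M : Type w} [AddCommGroup M] [Module R M] {f g : NormalizedChains R Z →ₗ[R] M}
    (h : ∀ s, f (mk R Z s) = g (mk R Z s)) : f = g := by
  refine Submodule.linearMap_qext _ (Finsupp.lhom_ext' fun s => LinearMap.ext_ring ?_)
  exact h s

variable (R Z) in
/-- The chains of degree `n`. -/
def gr (dim : S → ℕ) (n : ℕ) : Submodule R (NormalizedChains R Z) :=
  Submodule.span R (mk R Z '' {s | dim s = n})

theorem mk_mem_gr (dim : S → ℕ) (s : S) : mk R Z s ∈ gr R Z dim (dim s) :=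
  Submodule.subset_span ⟨s, rfl, rfl⟩

variable (R Z) in
/-- The decomposition of a chain into its components of the various degrees. -/
def components (dim : S → ℕ) :
    NormalizedChains R Z →ₗ[R] DirectSum ℕ fun n => gr R Z dim n :=
  lift (fun s => DirectSum.lof R ℕ (fun n => gr R Z dim n) (dim s) ⟨mk R Z s, mk_mem_gr dim s⟩)
    fun s hs => by
      have : (⟨mk R Z s, mk_mem_gr dim s⟩ : gr R Z dim (dim s)) = 0 :=
        Subtype.ext (mk_eq_zero s hs)
      rw [this, map_zero]

theorem components_of_mem (dim : S → ℕ) (n : ℕ) (c : NormalizedChains R Z)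
    (hc : c ∈ gr R Z dim n) :
    components R Z dim c = DirectSum.lof R ℕ (fun n => gr R Z dim n) n ⟨c, hc⟩ := by
  refine Submodule.span_induction (p := fun c hc => components R Z dim c =
    DirectSum.lof R ℕ (fun n => gr R Z dim n) n ⟨c, hc⟩) ?_ ?_ ?_ ?_ hc
  · rintro _ ⟨s, rfl, rfl⟩
    exact lift_mk _ _ s
  · rw [map_zero]
    exact (map_zero _).symm
  · intro a b ha hb iha ihb
    rw [map_add, iha, ihb]
    exact (map_add (DirectSum.lof R ℕ (fun n => gr R Z dim n) n) ⟨a, ha⟩ ⟨b, hb⟩).symm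
  · intro r a ha iha
    rw [map_smul, iha]
    exact (map_smul (DirectSum.lof R ℕ (fun n => gr R Z dim n) n) r ⟨a, ha⟩).symm

variable (R Z) in
/-- Normalized chains are the direct sum of the chains of the various degrees. -/
def decomposition (dim : S → ℕ) : DirectSum.Decomposition (gr R Z dim) :=
  .ofLinearMap (gr R Z dim) (components R Z dim)
    (hom_ext fun s => by
      rw [LinearMap.comp_apply, components, lift_mk, DirectSum.coeLinearMap_lof,
        LinearMap.id_apply])
    (DirectSum.linearMap_ext R fun n => LinearMap.ext fun c => by
      rw [LinearMap.comp_apply, LinearMap.comp_apply, DirectSum.coeLinearMap_lof]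
      exact components_of_mem (R := R) (Z := Z) dim n c.1 c.2)

end NormalizedChains

open NormalizedChains (mk_eq_zero lift_mk hom_ext)

/-! ### Normalized cubical chains -/

namespace CubicalSet

variable (R : Type t) [CommRing R]

/-- The degenerate elements of a cubical set. -/
def degenerate (Q : CubicalSet.{u}) : Set Q.carrier := {x | ∃ i y, i ≤ Q.dim y ∧ x = Q.degen i y}

/-- The class of an element of a cubical set in the normalized chain complex. -/
abbrev chain (Q : CubicalSet.{u}) (x : Q.carrier) : NormalizedChains R Q.degenerate :=
  NormalizedChains.mk R Q.degenerate x

theorem chain_degen (Q : CubicalSet.{u}) (i : ℕ) (x : Q.carrier) (h : i ≤ Q.dim x) :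
    Q.chain R (Q.degen i x) = 0 :=
  mk_eq_zero _ ⟨i, x, h, rfl⟩

/-- The normalized chain complex `C_*^□(Q)`, with `d x = ∑_{i=1}^n (-1)^i (d_i^0 x - d_i^1 x)`. -/
def chains (Q : CubicalSet.{u}) : DGModule.{max u t, t} R where
  carrier := NormalizedChains R Q.degenerate
  gr := NormalizedChains.gr R Q.degenerate Q.dim
  d := NormalizedChains.lift (fun x => ∑ i ∈ Finset.range (Q.dim x),
      (-1 : R) ^ (i + 1) • (Q.chain R (Q.face false i x) - Q.chain R (Q.face true i x))) (by
    rintro _ ⟨j, y, hj, rfl⟩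
    refine Finset.sum_eq_zero fun i hi => ?_
    rw [Finset.mem_range, Q.dim_degen _ _ hj] at hi
    have key : Q.chain R (Q.face false i (Q.degen j y)) = Q.chain R (Q.face true i (Q.degen j y)) := by
      rcases lt_trichotomy i j with h | rfl | h
      · have h1 := Q.dim_face false i y (by omega)
        have h2 := Q.dim_face true i y (by omega)
        rw [Q.face_degen_of_lt _ _ _ _ h hj, Q.face_degen_of_lt _ _ _ _ h hj,
          Q.chain_degen R _ _ (by omega), Q.chain_degen R _ _ (by omega)]
      · rw [Q.face_degen_self _ _ _ hj, Q.face_degen_self _ _ _ hj]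
      · have h1 := Q.dim_face false (i - 1) y (by omega)
        have h2 := Q.dim_face true (i - 1) y (by omega)
        rw [Q.face_degen_of_gt _ _ _ _ h (by omega), Q.face_degen_of_gt _ _ _ _ h (by omega),
          Q.chain_degen R _ _ (by omega), Q.chain_degen R _ _ (by omega)]
    rw [key, sub_self, smul_zero])

end CubicalSet

/-- The action `C_*^□(Q) ⊗ C_*^□(L) → C_*^□(L)` induced by a module structure `Q × L → L`. -/
def CubicalModule.chainAct (R : Type t) [CommRing R] {Q : MonoidalCubicalSet.{v}}
    (L : CubicalModule.{v, w} Q) :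
    (Q.toCubicalSet.chains R).carrier →ₗ[R]
      (L.toCubicalSet.chains R).carrier →ₗ[R] (L.toCubicalSet.chains R).carrier :=
  NormalizedChains.lift
    (M := NormalizedChains R L.degenerate →ₗ[R] NormalizedChains R L.degenerate)
    (fun a => NormalizedChains.lift (fun y => L.toCubicalSet.chain R (L.act a y)) (by
      rintro _ ⟨j, y, hj, rfl⟩
      rw [← L.degen_act_right _ _ _ hj]
      exact L.toCubicalSet.chain_degen R _ _ (by rw [L.dim_act]; omega))) (by
    rintro _ ⟨j, a, hj, rfl⟩
    refine hom_ext fun y => ?_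
    rw [lift_mk, ← L.degen_act_left _ _ _ hj]
    exact L.toCubicalSet.chain_degen R _ _ (by rw [L.dim_act]; omega))

/-! ### Differential graded coalgebras and the chains of a simplicial set -/

/-- A graded module with an endomorphism `d`, a comultiplication and a counit. -/
structure DGCoalgebra (R : Type t) [CommRing R] extends DGModule.{v, t} R where
  decomposition : DirectSum.Decomposition gr
  comul : carrier →ₗ[R] carrier ⊗[R] carrier
  counit : carrier →ₗ[R] R

attribute [instance] DGCoalgebra.decomposition

namespace DGCoalgebra

variable {R : Type t} [CommRing R] (C : DGCoalgebra.{v, t} R)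

/-- The linear map `c ↦ (-1)^{|c|} c`. -/
def sign : C.carrier →ₗ[R] C.carrier :=
  DirectSum.toModule R ℕ C.carrier (fun n => (-1 : R) ^ n • (C.gr n).subtype) ∘ₗ
    (DirectSum.decomposeLinearEquiv C.gr).toLinearMap

/-- The elements of positive degree. -/
def positive : Submodule R C.carrier := ⨆ n, C.gr (n + 1)

/-- The projection to the elements of positive degree. -/
def toPositive : C.carrier →ₗ[R] C.positive :=
  DirectSum.toModule R ℕ C.positive (fun n => match n with
    | 0 => 0
    | n + 1 => Submodule.inclusion (le_iSup (fun n => C.gr (n + 1)) n)) ∘ₗ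
    (DirectSum.decomposeLinearEquiv C.gr).toLinearMap

theorem sign_of_mem (n : ℕ) (c : C.carrier) (hc : c ∈ C.gr n) : C.sign c = (-1 : R) ^ n • c := by
  rw [sign, LinearMap.comp_apply, LinearEquiv.coe_coe, DirectSum.decomposeLinearEquiv_apply,
    DirectSum.decompose_of_mem _ hc]
  exact DirectSum.toModule_lof R n _

theorem toPositive_of_mem_zero (c : C.carrier) (hc : c ∈ C.gr 0) : C.toPositive c = 0 := by
  rw [toPositive, LinearMap.comp_apply, LinearEquiv.coe_coe, DirectSum.decomposeLinearEquiv_apply,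
    DirectSum.decompose_of_mem _ hc]
  exact DirectSum.toModule_lof R 0 _

theorem toPositive_of_mem (n : ℕ) (c : C.carrier) (hc : c ∈ C.gr (n + 1)) :
    (C.toPositive c : C.carrier) = c := by
  rw [toPositive, LinearMap.comp_apply, LinearEquiv.coe_coe, DirectSum.decomposeLinearEquiv_apply,
    DirectSum.decompose_of_mem _ hc]
  exact congrArg Subtype.val (DirectSum.toModule_lof R (n + 1) _)

/-- `C` is a 1-reduced differential graded coalgebra. -/
structure IsOneReducedDGCoalgebra : Prop where
  isChainComplex : C.IsChainComplex
  comul_mem : ∀ n, ∀ c ∈ C.gr n, C.comul c ∈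
    ⨆ p : {p : ℕ × ℕ // p.1 + p.2 = n},
      Submodule.map₂ (TensorProduct.mk R C.carrier C.carrier) (C.gr p.1.1) (C.gr p.1.2)
  comul_d : C.comul ∘ₗ C.d =
    (TensorProduct.map C.d .id + TensorProduct.map C.sign C.d) ∘ₗ C.comul
  coassoc : (TensorProduct.assoc R C.carrier C.carrier C.carrier).toLinearMap ∘ₗ
    TensorProduct.map C.comul .id ∘ₗ C.comul = TensorProduct.map .id C.comul ∘ₗ C.comul
  counit_of_mem : ∀ n, ∀ c ∈ C.gr (n + 1), C.counit c = 0
  counit_comul_left : ∀ c, TensorProduct.lid R C.carrier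
    (TensorProduct.map C.counit .id (C.comul c)) = c
  counit_comul_right : ∀ c, TensorProduct.rid R C.carrier
    (TensorProduct.map .id C.counit (C.comul c)) = c
  bijective_counit : Function.Bijective (C.counit.domRestrict (C.gr 0))
  gr_one : C.gr 1 = ⊥

end DGCoalgebra

namespace Simplex

variable (R : Type t) [CommRing R]

/-- The last degeneracies `s_n x`, for `n`-simplices `x`, `n ≥ 0`. -/
def lastDegenerate (X : SSet.{u}) : Set (Simplex X) := {x | ∃ y : Simplex X, x = y.degen y.dim}

/-- The class of a simplex `x` in `C_*(X)`. -/
abbrev chain {X : SSet.{u}} (x : Simplex X) : NormalizedChains R (lastDegenerate X) :=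
  NormalizedChains.mk R (lastDegenerate X) x

theorem chain_degen {X : SSet.{u}} (x : Simplex X) (n : ℕ) (hn : n = x.dim) :
    chain R (x.degen n) = 0 :=
  mk_eq_zero _ ⟨x, by rw [hn]⟩

end Simplex

open Simplex in
/-- The differential graded coalgebra `C_*(X)`: chains modulo the last degeneracies, with the
differential `d x = ∑ (-1)^i ∂_i x` and the Alexander-Whitney diagonal. -/
def simplicialChains (R : Type t) [CommRing R] (X : SSet.{u}) : DGCoalgebra.{max u t, t} R where
  carrier := NormalizedChains R (lastDegenerate X)
  gr := NormalizedChains.gr R (lastDegenerate X) Simplex.dim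
  decomposition := NormalizedChains.decomposition R (lastDegenerate X) Simplex.dim
  d := NormalizedChains.lift (fun x => if x.dim = 0 then 0 else
      ∑ i ∈ Finset.range (x.dim + 1), (-1 : R) ^ i • (x.face i).chain R) (by
    rintro _ ⟨x, rfl⟩
    rw [dim_degen, if_neg (by omega), Finset.sum_range_succ, Finset.sum_range_succ,
      face_degen_self _ _ le_rfl, face_degen_self _ _ (Nat.le_succ _), pow_succ, mul_neg_one,
      neg_smul, add_neg_cancel_right]
    refine Finset.sum_eq_zero fun i hi => ?_
    rw [Finset.mem_range] at hi
    rw [face_degen_of_lt _ _ hi, chain_degen R (x.face i) (x.dim - 1) rfl, smul_zero])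
  comul := NormalizedChains.lift (fun x => ∑ i ∈ Finset.range (x.dim + 1), (x.front i).chain R ⊗ₜ (x.back i).chain R)
    (by
      rintro _ ⟨x, rfl⟩
      rw [dim_degen, Finset.sum_range_succ, ← dim_degen x.dim x, front_self, chain_degen R _ _ rfl,
        TensorProduct.zero_tmul, add_zero]
      refine Finset.sum_eq_zero fun i hi => ?_
      rw [Finset.mem_range, dim_degen] at hi
      rw [back_degen _ _ (by omega), chain_degen R (x.back i) (x.dim - i) rfl, TensorProduct.tmul_zero])
  counit := NormalizedChains.lift (fun x => if x.dim = 0 then 1 else 0) (by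
    rintro _ ⟨x, rfl⟩
    rw [dim_degen, if_neg (by omega)])

/-! ### The cobar construction -/

namespace DGCoalgebra

variable {R : Type t} [CommRing R] (C : DGCoalgebra.{v, t} R)

/-- The underlying algebra `T(s^{-1} C_{>0})` of the cobar construction. -/
abbrev CobarAlgebra : Type (max v t) := TensorAlgebra R C.positive

/-- The generator `[c̄]` given by the component of `c` in positive degrees. -/
def letter : C.carrier →ₗ[R] C.CobarAlgebra := TensorAlgebra.ι R ∘ₗ C.toPositive

/-- The differential on generators:
`d [c̄] = -[dc] + ∑ (-1)^{|c'|} [c'|c'']` where `Δ c = c ⊗ 1 + 1 ⊗ c + ∑ c' ⊗ c''`. -/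
def cobarLetterD : C.carrier →ₗ[R] C.CobarAlgebra :=
  -(C.letter ∘ₗ C.d) + LinearMap.mul' R C.CobarAlgebra ∘ₗ
    TensorProduct.map (C.letter ∘ₗ C.sign) C.letter ∘ₗ C.comul

/-- The algebra map `a ↦ (-1)^{|a|} a`, where `[c̄]` has degree `|c| - 1`. -/
def cobarSign : C.CobarAlgebra →ₐ[R] C.CobarAlgebra :=
  TensorAlgebra.lift R (-(C.letter ∘ₗ C.sign) ∘ₗ C.positive.subtype)

/-- The algebra map `a ↦ ((-1)^{|a|} a, d a; 0, a)` to upper triangular matrices, which encodes the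
extension of the differential to a derivation. -/
def cobarMatrix : C.CobarAlgebra →ₐ[R] Matrix (Fin 2) (Fin 2) C.CobarAlgebra :=
  TensorAlgebra.lift R
    { toFun c := !![-C.letter (C.sign c), C.cobarLetterD c; 0, C.letter c]
      map_add' a b := by
        ext i j
        fin_cases i <;> fin_cases j <;> simp [add_comm]
      map_smul' r a := by
        ext i j
        fin_cases i <;> fin_cases j <;> simp }

/-- The differential of the cobar construction. -/
def cobarD : C.CobarAlgebra →ₗ[R] C.CobarAlgebra where
  toFun a := C.cobarMatrix a 0 1
  map_add' a b := by rw [map_add]; rfl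
  map_smul' r a := by rw [map_smul]; rfl

theorem ι_eq_letter (c : C.positive) : TensorAlgebra.ι R c = C.letter c := by
  have h : C.toPositive ∘ₗ C.positive.subtype = .id := by
    refine LinearMap.ext fun c => ?_
    obtain ⟨c, hc⟩ := c
    refine Subtype.ext ?_
    change (C.toPositive c : C.carrier) = c
    induction hc using Submodule.iSup_induction' with
    | mem n c hc => exact C.toPositive_of_mem n c hc
    | zero => simp
    | add a b _ _ ha hb => rw [map_add, Submodule.coe_add, ha, hb]
  exact congrArg (TensorAlgebra.ι R) (LinearMap.congr_fun h c).symm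

theorem cobarMatrix_ι (c : C.positive) : C.cobarMatrix (TensorAlgebra.ι R c) =
    !![-C.letter (C.sign c), C.cobarLetterD c; 0, C.letter c] :=
  TensorAlgebra.lift_ι_apply _ _

theorem cobarD_ι (c : C.positive) : C.cobarD (TensorAlgebra.ι R c) = C.cobarLetterD c := by
  change C.cobarMatrix _ 0 1 = _
  rw [cobarMatrix_ι]
  rfl

theorem cobarMatrix_apply (a : C.CobarAlgebra) :
    C.cobarMatrix a = !![C.cobarSign a, C.cobarD a; 0, a] := by
  induction a using TensorAlgebra.induction with
  | algebraMap r =>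
    rw [AlgHom.commutes, AlgHom.commutes]
    have : C.cobarD (algebraMap R _ r) = 0 := by
      change C.cobarMatrix (algebraMap R _ r) 0 1 = 0
      rw [AlgHom.commutes]
      simp [Matrix.algebraMap_matrix_apply]
    rw [this]
    ext i j
    fin_cases i <;> fin_cases j <;> simp [Matrix.algebraMap_matrix_apply]
  | ι c =>
    rw [cobarD_ι, cobarMatrix_ι, cobarSign, TensorAlgebra.lift_ι_apply, ι_eq_letter]
    rfl
  | mul a b ha hb =>
    have h : C.cobarD (a * b) = C.cobarSign a * C.cobarD b + C.cobarD a * b := by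
      change C.cobarMatrix (a * b) 0 1 = _
      rw [map_mul, ha, hb]
      simp [Matrix.mul_apply, Fin.sum_univ_two]
    rw [h, map_mul, map_mul, ha, hb]
    ext i j
    fin_cases i <;> fin_cases j <;> simp [Matrix.mul_apply, Fin.sum_univ_two]
  | add a b ha hb =>
    rw [map_add, map_add, map_add, ha, hb]
    ext i j
    fin_cases i <;> fin_cases j <;> simp

theorem cobarD_mul (a b : C.CobarAlgebra) :
    C.cobarD (a * b) = C.cobarD a * b + C.cobarSign a * C.cobarD b := by
  change C.cobarMatrix (a * b) 0 1 = _
  rw [map_mul, cobarMatrix_apply, cobarMatrix_apply]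
  simp [Matrix.mul_apply, Fin.sum_univ_two, add_comm]

/-- The cobar construction `ΩC`; the product `[c̄_1|…|c̄_k]` has degree `∑ (|c_i| - 1)`. -/
def cobar : DGModule.{max v t, t} R where
  carrier := C.CobarAlgebra
  gr n := Submodule.span R {a | ∃ l : List (Σ m : ℕ, C.gr (m + 1)),
    (l.map Sigma.fst).sum = n ∧ a = (l.map fun c => C.letter c.2).prod}
  d := C.cobarD

/-! ### Twisting cochains and twisted tensor products -/

/-- A twisting cochain: a linear map `φ` of degree `-1` from `C` to an algebra `A` with Brown's
condition `d φ + φ d = - φ ⌣ φ`, where `(φ ⌣ φ)(c) = ∑ (-1)^{|c'|} φ(c') φ(c'')`. -/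
structure IsTwistingCochain (A : DGModule.{w, t} R)
    (mul : A.carrier →ₗ[R] A.carrier →ₗ[R] A.carrier) (φ : C.carrier →ₗ[R] A.carrier) : Prop where
  map_mem : ∀ n, ∀ c ∈ C.gr (n + 1), φ c ∈ A.gr n
  map_eq_zero : ∀ c ∈ C.gr 0, φ c = 0
  brown : A.d ∘ₗ φ + φ ∘ₗ C.d =
    -(TensorProduct.lift mul ∘ₗ TensorProduct.map (φ ∘ₗ C.sign) φ ∘ₗ C.comul)

/-- The cap product `φ ∩ (c ⊗ m) = ∑ (-1)^{|c'|} c' ⊗ φ(c'') m`. -/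
def cap {A : Type*} [AddCommGroup A] [Module R A] {M : Type*} [AddCommGroup M] [Module R M]
    (act : A →ₗ[R] M →ₗ[R] M) (φ : C.carrier →ₗ[R] A) :
    C.carrier ⊗[R] M →ₗ[R] C.carrier ⊗[R] M :=
  TensorProduct.map .id (TensorProduct.lift act) ∘ₗ
    (TensorProduct.assoc R C.carrier A M).toLinearMap ∘ₗ
    TensorProduct.map (TensorProduct.map C.sign φ ∘ₗ C.comul) .id

/-- The twisted tensor product `C ⊗_φ M`, with the differential `d ⊗ 1 + 1 ⊗ d + φ ∩ -`. -/
def twistedTensor {A : Type*} [AddCommGroup A] [Module R A] (M : DGModule.{w, t} R)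
    (act : A →ₗ[R] M.carrier →ₗ[R] M.carrier) (φ : C.carrier →ₗ[R] A) : DGModule.{max v w, t} R where
  carrier := C.carrier ⊗[R] M.carrier
  gr n := ⨆ p : {p : ℕ × ℕ // p.1 + p.2 = n},
    Submodule.map₂ (TensorProduct.mk R C.carrier M.carrier) (C.gr p.1.1) (M.gr p.1.2)
  d := TensorProduct.map C.d .id + TensorProduct.map C.sign M.d + C.cap act φ

/-- The universal twisting cochain `C → ΩC`, `c ↦ -[c̄]`. -/
def universalCochain : C.carrier →ₗ[R] C.cobar.carrier := -C.letter

/-- The multiplication of the cobar construction. -/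
def cobarMul : C.cobar.carrier →ₗ[R] C.cobar.carrier →ₗ[R] C.cobar.carrier :=
  LinearMap.mul R C.CobarAlgebra

/-- The acyclic cobar construction `Ω(C; C)`. -/
def acyclicCobar : DGModule.{max v t, t} R :=
  C.twistedTensor C.cobar C.cobarMul C.universalCochain

end DGCoalgebra

/-- The twisting cochain `τ_* : C_*(X) → C_{*-1}^□(Q)` of a truncating twisting function:
`τ_* x = -τ(x)` if `dim x ≥ 2`, and `τ_* x = 0` if `dim x ≤ 1`. -/
def TruncatingTwistingFunction.cochain (R : Type t) [CommRing R] {X : SSet.{u}}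
    {Q : MonoidalCubicalSet.{v}} (τ : TruncatingTwistingFunction X Q) :
    (simplicialChains R X).carrier →ₗ[R] (Q.toCubicalSet.chains R).carrier :=
  NormalizedChains.lift (M := NormalizedChains R Q.toCubicalSet.degenerate)
    (fun x => if 2 ≤ x.dim then -Q.toCubicalSet.chain R (τ.toFun x) else 0) (by
    rintro _ ⟨x, rfl⟩
    split_ifs with h
    · rw [Simplex.dim_degen] at h
      have := τ.dim_toFun x (by omega)
      rw [← τ.degen_last x (by omega), Q.chain_degen R _ _ (by omega), neg_zero]
    · rfl)

end

/-!
All chain modules in question are free on explicit generators modulo explicit degenerate ones, so the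
isomorphisms come from universal properties, and the work lies in matching the differentials.

For a cubical set generated by a graded set `P` with freely adjoined degeneracies, the normalized
chains are the free module on `P` modulo the elements of `P` that are declared to be degenerate
(`SemiCubicalSet.cubeLift`, `SemiCubicalSet.cube_hom_ext`): every other element of the cubical set
has an added coordinate and is thus degenerate.

For `X ×_τ L` this gives `(x, y) ↔ x ⊗ y` at once. In the cubical differential of `(x, y)` the faces
in the direction of `L` give `1 ⊗ d`, and the faces `d_i^1` in the direction of `x` give `d ⊗ 1`
except for the last summand, which is the face `d_p^0`, where `τ` is evaluated on a 1-simplex and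
gives the unit. The other faces `d_i^0` are the cap product with `τ_*`
(`TwistedProduct.toTensor_d`). The same bookkeeping for `τ(x)` in place of `(x, y)` is Brown's
condition for `τ_*` (`TruncatingTwistingFunction.brown_cochain`).

The chains of `𝛀X` are spanned by words, and a word goes to the product of its letters in the tensor
algebra. The inverse uses the action of the tensor algebra on the chains of `𝛀X` in which `[x̄]` acts
as the multiplication by `x̄`, applied to the unit (`LoopSet.cobarEquiv`); 1-reducedness enters since
`[x̄]` has to vanish for the 1-simplex, which it does because that simplex is a last degeneracy.
Brown's condition for the universal truncating twisting function is exactly the defining formula of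
the cobar differential on letters (`LoopSet.toCobar_brown`), and both differentials are derivations,
so the isomorphism is one of complexes. It carries the twisting cochain of the universal truncating
twisting function to the universal twisting cochain, and hence the twisted tensor product that
belongs to `𝐏X` to the acyclic cobar construction (`DGCoalgebra.isIso_lTensor`).

That the targets are chain complexes follows from the isomorphisms, since normalized cubical chains
always form a chain complex; for the coalgebra `C_*(X)` the identities are checked directly.
-/

noncomputable section

/-! ### Complexes and cubical chains -/

/-- Double sums over pairs of face operators cancel as soon as `F` satisfies the symmetry that
comes from the relation `∂_j ∂_i = ∂_i ∂_{j+1}` for `i ≤ j`. -/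
theorem sum_sum_alternating_eq_zero {R : Type*} [CommRing R] {M : Type*} [AddCommGroup M]
    [Module R M] (n : ℕ) (F : ℕ → ℕ → M)
    (hF : ∀ i j, i ≤ j → j < n → F i j = F (j + 1) i) :
    ∑ i ∈ Finset.range (n + 1), ∑ j ∈ Finset.range n, (-1 : R) ^ (i + j) • F i j = 0 := by
  rw [← Finset.sum_product']
  refine Finset.sum_involution
    (fun p _ => if p.1 ≤ p.2 then (p.2 + 1, p.1) else (p.2, p.1 - 1)) ?_ ?_ ?_ ?_
  · rintro ⟨i, j⟩ h
    simp only [Finset.mem_product, Finset.mem_range] at h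
    split_ifs with hij
    · simp only at hij ⊢
      rw [hF i j hij h.2, show j + 1 + i = i + j + 1 by omega, pow_succ, mul_neg_one, neg_smul,
        add_neg_cancel]
    · simp only at hij ⊢
      obtain ⟨i, rfl⟩ : ∃ k, i = k + 1 := ⟨i - 1, by omega⟩
      rw [Nat.add_sub_cancel, hF j i (by omega) (by omega), show i + 1 + j = j + i + 1 by omega,
        pow_succ, mul_neg_one, neg_smul, neg_add_cancel]
  · rintro ⟨i, j⟩ h _
    split_ifs with hij <;> simp only [ne_eq, Prod.mk.injEq] at hij ⊢ <;> omega
  · rintro ⟨i, j⟩ h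
    simp only [Finset.mem_product, Finset.mem_range] at h ⊢
    split_ifs with hij <;> simp only at hij ⊢ <;> omega
  · rintro ⟨i, j⟩ h
    simp only [Finset.mem_product, Finset.mem_range] at h ⊢
    by_cases hij : i ≤ j
    · simp only [hij, if_true]
      rw [if_neg (by omega), Nat.add_sub_cancel]
    · simp only [hij, if_false]
      rw [if_pos (by omega), Nat.sub_add_cancel (by omega)]

namespace DGModule

variable {R : Type t} [CommRing R]

theorem IsChainComplex.of_isIso {C : DGModule.{v, t} R} {D : DGModule.{w, t} R}
    {f : C.carrier ≃ₗ[R] D.carrier} (hf : IsIso f) (hC : C.IsChainComplex) :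
    D.IsChainComplex := by
  obtain ⟨hgr, hd⟩ := hf
  have hmem : ∀ n, ∀ c ∈ D.gr n, ∃ b ∈ C.gr n, f b = c := by
    intro n c hc
    rw [← hgr] at hc
    exact hc
  refine ⟨?_, ?_, ?_, ?_⟩
  · obtain ⟨h1, h2⟩ := (DirectSum.isInternal_submodule_iff_iSupIndep_and_iSup_eq_top _).1 hC.isInternal
    rw [DirectSum.isInternal_submodule_iff_iSupIndep_and_iSup_eq_top]
    have e : D.gr = fun n => (C.gr n).map f.toLinearMap := funext fun n => (hgr n).symm
    rw [e]
    refine ⟨h1.map_orderIso (Submodule.orderIsoMapComap f), ?_⟩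
    rw [← Submodule.map_iSup, h2, Submodule.map_top, LinearEquiv.range]
  · intro n c hc
    obtain ⟨b, hb, rfl⟩ := hmem _ c hc
    rw [← hd, ← hgr]
    exact ⟨_, hC.d_mem n b hb, rfl⟩
  · intro c hc
    obtain ⟨b, hb, rfl⟩ := hmem _ c hc
    rw [← hd, hC.d_eq_zero b hb, map_zero]
  · intro c
    obtain ⟨b, rfl⟩ := f.surjective c
    rw [← hd, ← hd, hC.d_d, map_zero]

theorem IsIso.trans {B : DGModule.{u, t} R} {C : DGModule.{v, t} R} {D : DGModule.{w, t} R}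
    {f : B.carrier ≃ₗ[R] C.carrier} {g : C.carrier ≃ₗ[R] D.carrier} (hf : IsIso f)
    (hg : IsIso g) : IsIso (f.trans g) := by
  refine ⟨fun n => ?_, fun c => ?_⟩
  · rw [← hg.1, ← hf.1, ← Submodule.map_comp]
    rfl
  · rw [LinearEquiv.trans_apply, LinearEquiv.trans_apply, hf.2, hg.2]

end DGModule

namespace NormalizedChains

variable {R : Type t} [CommRing R] {S : Type v} {Z : Set S}

theorem isInternal_gr (dim : S → ℕ) : DirectSum.IsInternal (gr R Z dim) :=
  letI := decomposition R Z dim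
  DirectSum.Decomposition.isInternal _

end NormalizedChains

namespace CubicalSet

variable (R : Type t) [CommRing R]

/-- The class of an element of a cubical set, as an element of the complex of chains. -/
def cell (Q : CubicalSet.{u}) (x : Q.carrier) : (Q.chains R).carrier := Q.chain R x

variable {R} in
/-- The linear map on chains with prescribed values on the elements of a cubical set, which vanish
on the degenerate elements. -/
def chainsLift (Q : CubicalSet.{u}) {M : Type w} [AddCommGroup M] [Module R M] (F : Q.carrier → M)
    (hF : ∀ i x, i ≤ Q.dim x → F (Q.degen i x) = 0) : (Q.chains R).carrier →ₗ[R] M :=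
  NormalizedChains.lift (Z := Q.degenerate) F (by rintro _ ⟨i, x, hi, rfl⟩; exact hF i x hi)

variable {R} in
theorem chainsLift_cell (Q : CubicalSet.{u}) {M : Type w} [AddCommGroup M] [Module R M]
    (F : Q.carrier → M) (hF : ∀ i x, i ≤ Q.dim x → F (Q.degen i x) = 0) (x : Q.carrier) :
    Q.chainsLift F hF (Q.cell R x) = F x :=
  NormalizedChains.lift_mk F _ x

variable {R} in
/-- Linear maps on cubical chains are determined by their values on the elements. -/
theorem chains_hom_ext (Q : CubicalSet.{u}) {M : Type w} [AddCommGroup M] [Module R M]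
    {f g : (Q.chains R).carrier →ₗ[R] M} (h : ∀ x, f (Q.cell R x) = g (Q.cell R x)) : f = g :=
  @NormalizedChains.hom_ext R _ _ Q.degenerate M _ _ f g h

theorem cell_degen (Q : CubicalSet.{u}) (i : ℕ) (x : Q.carrier) (h : i ≤ Q.dim x) :
    Q.cell R (Q.degen i x) = 0 :=
  Q.chain_degen R i x h

theorem chains_d_cell (Q : CubicalSet.{u}) (x : Q.carrier) :
    (Q.chains R).d (Q.cell R x) = ∑ i ∈ Finset.range (Q.dim x),
      (-1 : R) ^ (i + 1) • (Q.cell R (Q.face false i x) - Q.cell R (Q.face true i x)) := by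
  dsimp only [chains, cell]
  exact NormalizedChains.lift_mk _ _ x

theorem chains_gr (Q : CubicalSet.{u}) (n : ℕ) :
    (Q.chains R).gr n = Submodule.span R (Q.cell R '' {x | Q.dim x = n}) :=
  rfl

theorem cell_mem_gr (Q : CubicalSet.{u}) {x : Q.carrier} {n : ℕ} (h : Q.dim x = n) :
    Q.cell R x ∈ (Q.chains R).gr n := by
  rw [chains_gr]
  exact Submodule.subset_span ⟨x, h, rfl⟩

theorem isChainComplex_chains (Q : CubicalSet.{u}) : (Q.chains R).IsChainComplex where
  isInternal := NormalizedChains.isInternal_gr Q.dim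
  d_mem n c hc := by
    suffices (Q.chains R).gr (n + 1) ≤ ((Q.chains R).gr n).comap (Q.chains R).d from this hc
    refine Submodule.span_le.2 ?_
    rintro _ ⟨x, hx, rfl⟩
    change (Q.chains R).d (Q.cell R x) ∈ (Q.chains R).gr n
    change Q.dim x = n + 1 at hx
    rw [chains_d_cell]
    refine Submodule.sum_mem _ fun i hi => Submodule.smul_mem _ _ (Submodule.sub_mem _ ?_ ?_)
    all_goals
      rw [Finset.mem_range] at hi
      refine Q.cell_mem_gr R ?_
    · have := Q.dim_face false i x hi; omega
    · have := Q.dim_face true i x hi; omega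
  d_eq_zero c hc := by
    suffices (Q.chains R).gr 0 ≤ LinearMap.ker (Q.chains R).d from this hc
    refine Submodule.span_le.2 ?_
    rintro _ ⟨x, hx, rfl⟩
    change Q.dim x = 0 at hx
    change (Q.chains R).d (Q.cell R x) = 0
    simp [chains_d_cell, hx]
  d_d c := by
    suffices (Q.chains R).d ∘ₗ (Q.chains R).d = 0 from LinearMap.congr_fun this c
    refine Q.chains_hom_ext fun x => ?_
    rw [LinearMap.comp_apply, chains_d_cell, map_sum, LinearMap.zero_apply]
    rcases hn : Q.dim x with _ | n
    · simp
    have hx (ε) (i) (hi : i ∈ Finset.range (n + 1)) : Q.dim (Q.face ε i x) = n := by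
      have := Q.dim_face ε i x (by simpa [hn] using hi); omega
    let c (ε ε' : Bool) (i j : ℕ) : (Q.chains R).carrier :=
      Q.cell R (Q.face ε' j (Q.face ε i x))
    refine Eq.trans (Finset.sum_congr rfl fun i hi => ?_) (sum_sum_alternating_eq_zero (R := R) n
      (fun i j => c false false i j - c false true i j - c true false i j + c true true i j) ?_)
    · rw [map_smul, map_sub, chains_d_cell, chains_d_cell, hx _ _ hi, hx _ _ hi,
        ← Finset.sum_sub_distrib, Finset.smul_sum]
      refine Finset.sum_congr rfl fun j _ => ?_
      rw [← smul_sub, smul_smul, ← pow_add, show i + 1 + (j + 1) = i + j + 2 by omega, pow_add _ _ 2,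
        neg_one_sq, mul_one]
      congr 1
      simp only [c]
      abel
    · intro i j hij hj
      simp only [c]
      rw [Q.face_face _ _ i j x hij (by omega), Q.face_face _ _ i j x hij (by omega),
        Q.face_face _ _ i j x hij (by omega), Q.face_face _ _ i j x hij (by omega)]
      abel

end CubicalSet

namespace CubicalModule

variable (R : Type t) [CommRing R] {Q : MonoidalCubicalSet.{v}} (L : CubicalModule.{v, w} Q)

theorem chainAct_cell (a : Q.carrier) (y : L.carrier) :
    L.chainAct R (Q.cell R a) (L.cell R y) = L.cell R (L.act a y) := by
  dsimp only [chainAct, CubicalSet.cell]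
  erw [NormalizedChains.lift_mk, NormalizedChains.lift_mk]

/-- The differential is a derivation of the action. -/
theorem d_chainAct_cell (a : Q.carrier) (z : (L.chains R).carrier) :
    (L.chains R).d (L.chainAct R (Q.cell R a) z) =
      L.chainAct R ((Q.chains R).d (Q.cell R a)) z +
        (-1 : R) ^ Q.dim a • L.chainAct R (Q.cell R a) ((L.chains R).d z) := by
  suffices (L.chains R).d ∘ₗ L.chainAct R (Q.cell R a) =
      L.chainAct R ((Q.chains R).d (Q.cell R a)) +
        (-1 : R) ^ Q.dim a • (L.chainAct R (Q.cell R a) ∘ₗ (L.chains R).d) from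
    LinearMap.congr_fun this z
  refine L.toCubicalSet.chains_hom_ext fun y => ?_
  rw [LinearMap.comp_apply, LinearMap.add_apply, LinearMap.smul_apply, LinearMap.comp_apply,
    chainAct_cell, CubicalSet.chains_d_cell, L.dim_act, Finset.sum_range_add, CubicalSet.chains_d_cell,
    CubicalSet.chains_d_cell, map_sum, map_sum, LinearMap.sum_apply, Finset.smul_sum]
  congr 1
  · refine Finset.sum_congr rfl fun i hi => ?_
    rw [Finset.mem_range] at hi
    rw [map_smul, LinearMap.smul_apply, map_sub, LinearMap.sub_apply, chainAct_cell,
      chainAct_cell, L.face_act_left _ _ _ _ hi, L.face_act_left _ _ _ _ hi]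
  · refine Finset.sum_congr rfl fun i hi => ?_
    rw [Finset.mem_range] at hi
    rw [map_smul, map_sub, chainAct_cell, chainAct_cell, L.face_act_right _ _ _ _ hi,
      L.face_act_right _ _ _ _ hi, smul_smul, ← pow_add, add_assoc]

end CubicalModule

/-! ### Chains of a cubical set with formal degeneracies -/

namespace SemiCubicalSet

variable {P : SemiCubicalSet.{u}}

theorem dim_cube (g : P.carrier) : P.toCubicalSet.dim (cube g) = P.dim g :=
  List.length_replicate

theorem face_cube (ε : Bool) (i : ℕ) (g : P.carrier) (h : i < P.dim g) :
    P.toCubicalSet.face ε i (cube g) = cube (P.face ε i g) := by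
  refine congrArg (Quot.mk _) (Subtype.ext ?_)
  have e : List.replicate (P.dim g) true =
      List.replicate i true ++ true :: List.replicate (P.dim g - 1 - i) true := by
    rw [← List.replicate_succ, List.replicate_append_replicate]; congr 1; omega
  change rawFace ε i (g, List.replicate (P.dim g) true) = _
  rw [e, rawFace_split _ _ _ _ _ _ (by simp)]
  have := P.dim_face ε i g h
  refine Prod.ext ?_ ?_
  · simp
  · simp only [List.replicate_append_replicate]
    congr 1; omega

theorem cube_of_isDegen {k : ℕ} {g h : P.carrier} (hd : P.IsDegen k g h) (hk : k ≤ P.dim h) :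
    cube g = P.toCubicalSet.degen k (cube h) := by
  have hg := P.dim_of_isDegen _ _ _ hd
  refine Quot.sound (.of_eq g h (List.replicate k true) (List.replicate (P.dim h - k) true)
    (by simpa using hd) ?_ ?_)
  · refine Prod.ext rfl ?_
    rw [← List.replicate_succ, List.replicate_append_replicate]
    change List.replicate (P.dim g) true = _
    congr 1; omega
  · change rawDegen k (h, List.replicate (P.dim h) true) = _
    rw [← rawDegen_split k h (List.replicate k true) _ (by simp), List.replicate_append_replicate,
      Nat.add_sub_cancel' hk]

theorem eq_cube_or_eq_degen (x : P.toCubicalSet.carrier) : (∃ g, x = cube g) ∨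
    ∃ i y, i ≤ P.toCubicalSet.dim y ∧ x = P.toCubicalSet.degen i y := by
  obtain ⟨⟨⟨g, m⟩, hm⟩⟩ := x
  by_cases hf : false ∈ m
  · right
    obtain ⟨a, b, rfl⟩ := List.append_of_mem hf
    refine ⟨a.length, Quot.mk _ ⟨(g, a ++ b), by simpa using hm⟩, ?_, ?_⟩
    · change a.length ≤ (a ++ b).length
      simp
    · exact congrArg (Quot.mk _) (Subtype.ext (rawDegen_split _ g a b rfl).symm)
  · left
    have hm' : m = List.replicate m.length true :=
      List.eq_replicate_of_mem fun b hb => by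
        cases b
        · exact absurd hb hf
        · rfl
    refine ⟨g, congrArg (Quot.mk _) (Subtype.ext (Prod.ext rfl ?_))⟩
    have e : m.length = P.dim g := by
      rw [← hm]
      change m.length = m.count true
      conv_rhs => rw [hm']
      simp
    change m = List.replicate (P.dim g) true
    rw [← e]
    exact hm'

variable {R : Type t} [CommRing R]

/-- The linear map on the chains of the generated cubical set with prescribed values on `P`, which
vanish on the elements of `P` that are declared to be degenerate.  Together with `cube_hom_ext` this
says that these chains are the free module on `P` modulo its degenerate elements. -/
def cubeLift {M : Type w} [AddCommGroup M] [Module R M] (F : P.carrier → M)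
    (hF : ∀ k g h, P.IsDegen k g h → k ≤ P.dim h → F g = 0) :
    (P.toCubicalSet.chains R).carrier →ₗ[R] M :=
  P.toCubicalSet.chainsLift
    (Quot.lift (fun p : P.Formal => if false ∈ p.1.2 then 0 else F p.1.1) (by
      rintro _ _ ⟨g, h, a, b, hd, hg, hh⟩
      simp only [List.mem_append, List.mem_cons, true_or, or_true, if_true]
      rw [hF _ g h hd (by simp at hh; omega), ite_self]))
    (by
      rintro i ⟨p⟩ hi
      refine if_pos ?_
      change false ∈ _ ++ false :: _
      simp)

theorem cubeLift_cell {M : Type w} [AddCommGroup M] [Module R M] (F : P.carrier → M)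
    (hF : ∀ k g h, P.IsDegen k g h → k ≤ P.dim h → F g = 0) (g : P.carrier) :
    cubeLift (R := R) F hF (P.toCubicalSet.cell R (cube g)) = F g := by
  refine (P.toCubicalSet.chainsLift_cell _ _ _).trans (if_neg ?_)
  change false ∉ List.replicate _ true
  simp

theorem cube_hom_ext {M : Type w} [AddCommGroup M] [Module R M]
    {f f' : (P.toCubicalSet.chains R).carrier →ₗ[R] M}
    (h : ∀ g, f (P.toCubicalSet.cell R (cube g)) = f' (P.toCubicalSet.cell R (cube g))) :
    f = f' := by
  refine P.toCubicalSet.chains_hom_ext fun x => ?_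
  obtain ⟨g, rfl⟩ | ⟨i, y, hi, rfl⟩ := eq_cube_or_eq_degen x
  · exact h g
  · rw [CubicalSet.cell_degen _ _ _ _ hi, map_zero, map_zero]

theorem cell_of_isDegen {k : ℕ} {g h : P.carrier} (hd : P.IsDegen k g h) (hk : k ≤ P.dim h) :
    P.toCubicalSet.cell R (cube g) = 0 := by
  rw [cube_of_isDegen hd hk, CubicalSet.cell_degen]
  rwa [dim_cube]

variable (R) in
theorem chains_gr_eq_span_cube (n : ℕ) : (P.toCubicalSet.chains R).gr n =
    Submodule.span R ((fun g => P.toCubicalSet.cell R (cube g)) '' {g | P.dim g = n}) := by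
  rw [CubicalSet.chains_gr]
  refine le_antisymm (Submodule.span_le.2 ?_) (Submodule.span_mono ?_)
  · rintro _ ⟨x, hx, rfl⟩
    obtain ⟨g, rfl⟩ | ⟨i, y, hi, rfl⟩ := eq_cube_or_eq_degen x
    · exact Submodule.subset_span ⟨g, (dim_cube g).symm.trans hx, rfl⟩
    · rw [SetLike.mem_coe, CubicalSet.cell_degen _ _ _ _ hi]
      exact Submodule.zero_mem _
  · rintro _ ⟨g, hg, rfl⟩
    exact ⟨cube g, (dim_cube g).trans hg, rfl⟩

theorem chains_d_cube (g : P.carrier) :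
    (P.toCubicalSet.chains R).d (P.toCubicalSet.cell R (cube g)) =
      ∑ i ∈ Finset.range (P.dim g), (-1 : R) ^ (i + 1) •
        (P.toCubicalSet.cell R (cube (P.face false i g)) -
          P.toCubicalSet.cell R (cube (P.face true i g))) := by
  rw [CubicalSet.chains_d_cell, dim_cube]
  refine Finset.sum_congr rfl fun i hi => ?_
  rw [Finset.mem_range] at hi
  rw [face_cube _ _ _ hi, face_cube _ _ _ hi]

end SemiCubicalSet

/-! ### Chains of a simplicial set -/

namespace Simplex

variable (R : Type t) [CommRing R] {X : SSet.{u}}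

/-- The class of a simplex, as an element of the coalgebra of chains. -/
def cell (x : Simplex X) : (simplicialChains R X).carrier := x.chain R

theorem cell_degen (x : Simplex X) : (x.degen x.dim).cell R = 0 :=
  chain_degen R x _ rfl

variable {R} in
/-- The linear map on chains with prescribed values on the simplices, which vanish on the last
degeneracies. -/
def chainsLift {M : Type w} [AddCommGroup M] [Module R M] (F : Simplex X → M)
    (hF : ∀ x : Simplex X, F (x.degen x.dim) = 0) : (simplicialChains R X).carrier →ₗ[R] M :=
  NormalizedChains.lift (Z := lastDegenerate X) F (by rintro _ ⟨x, rfl⟩; exact hF x)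

variable {R} in
theorem chainsLift_cell {M : Type w} [AddCommGroup M] [Module R M] (F : Simplex X → M)
    (hF : ∀ x : Simplex X, F (x.degen x.dim) = 0) (x : Simplex X) :
    chainsLift F hF (x.cell R) = F x :=
  NormalizedChains.lift_mk F _ x

variable {R} in
theorem chains_hom_ext {M : Type w} [AddCommGroup M] [Module R M]
    {f g : (simplicialChains R X).carrier →ₗ[R] M}
    (h : ∀ x : Simplex X, f (x.cell R) = g (x.cell R)) : f = g :=
  @NormalizedChains.hom_ext R _ _ (lastDegenerate X) M _ _ f g h

theorem d_cell (x : Simplex X) : (simplicialChains R X).d (x.cell R) = if x.dim = 0 then 0 else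
    ∑ i ∈ Finset.range (x.dim + 1), (-1 : R) ^ i • (x.face i).cell R := by
  dsimp only [simplicialChains, cell]
  exact NormalizedChains.lift_mk _ _ x

theorem comul_cell (x : Simplex X) : (simplicialChains R X).comul (x.cell R) =
    ∑ i ∈ Finset.range (x.dim + 1), (x.front i).cell R ⊗ₜ (x.back i).cell R := by
  have h : ∃ hF, (simplicialChains R X).comul = chainsLift (R := R) (X := X) (fun x =>
      ∑ i ∈ Finset.range (x.dim + 1), (x.front i).cell R ⊗ₜ[R] (x.back i).cell R) hF := by
    refine ⟨fun x => ?_, rfl⟩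
    rw [dim_degen, Finset.sum_range_succ, ← dim_degen x.dim x, front_self, cell_degen,
      TensorProduct.zero_tmul, add_zero]
    refine Finset.sum_eq_zero fun i hi => ?_
    rw [Finset.mem_range, dim_degen] at hi
    rw [back_degen _ _ (by omega), ← dim_back, cell_degen, TensorProduct.tmul_zero]
  obtain ⟨hF, h⟩ := h
  rw [h, chainsLift_cell]

theorem counit_cell (x : Simplex X) :
    (simplicialChains R X).counit (x.cell R) = if x.dim = 0 then 1 else 0 := by
  dsimp only [simplicialChains, cell]
  exact NormalizedChains.lift_mk _ _ x

theorem gr_eq_span (n : ℕ) : (simplicialChains R X).gr n =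
    Submodule.span R (cell R '' {x : Simplex X | x.dim = n}) :=
  rfl

theorem cell_mem_gr {x : Simplex X} {n : ℕ} (h : x.dim = n) :
    x.cell R ∈ (simplicialChains R X).gr n := by
  rw [gr_eq_span]
  exact Submodule.subset_span ⟨x, h, rfl⟩

theorem sign_cell (x : Simplex X) :
    (simplicialChains R X).sign (x.cell R) = (-1 : R) ^ x.dim • x.cell R :=
  DGCoalgebra.sign_of_mem _ _ _ (cell_mem_gr R rfl)

variable {R} in
theorem cap_cell_tmul {A : Type v} [AddCommGroup A] [Module R A] {M : Type w} [AddCommGroup M]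
    [Module R M] (act : A →ₗ[R] M →ₗ[R] M) (φ : (simplicialChains R X).carrier →ₗ[R] A)
    (x : Simplex X) (m : M) : (simplicialChains R X).cap act φ (x.cell R ⊗ₜ m) =
      ∑ i ∈ Finset.range (x.dim + 1),
        (-1 : R) ^ i • (x.front i).cell R ⊗ₜ act (φ ((x.back i).cell R)) m := by
  rw [DGCoalgebra.cap]
  simp [comul_cell, TensorProduct.sum_tmul, sign_cell, TensorProduct.smul_tmul']

end Simplex

/-! ### The coalgebra of chains of a 1-reduced simplicial set -/

namespace Simplex

variable {X : SSet.{u}}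

theorem face_zero (x : Simplex X) : x.face 0 = x.back 1 := by
  unfold face back
  refine restrict_congr _ _ _ _ _ _ _ rfl fun v hv => ?_
  simp

theorem face_last (x : Simplex X) (n : ℕ) (h : x.dim = n + 1) : x.face (n + 1) = x.front n := by
  unfold face front
  refine restrict_congr _ _ _ _ _ _ _ (by omega) fun v hv => ?_
  rw [if_pos (by omega)]

variable (R : Type t) [CommRing R]

theorem isChainComplex_chains (X : SSet.{u}) : (simplicialChains R X).IsChainComplex where
  isInternal := NormalizedChains.isInternal_gr Simplex.dim
  d_mem n c hc := by
    suffices (simplicialChains R X).gr (n + 1) ≤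
      ((simplicialChains R X).gr n).comap (simplicialChains R X).d from this hc
    rw [gr_eq_span, Submodule.span_le]
    rintro _ ⟨x, hx, rfl⟩
    change x.dim = n + 1 at hx
    rw [SetLike.mem_coe, Submodule.mem_comap, d_cell, if_neg (by omega)]
    exact Submodule.sum_mem _ fun i _ => Submodule.smul_mem _ _
      (cell_mem_gr R (by rw [dim_face]; omega))
  d_eq_zero c hc := by
    suffices (simplicialChains R X).gr 0 ≤ LinearMap.ker (simplicialChains R X).d from this hc
    rw [gr_eq_span, Submodule.span_le]
    rintro _ ⟨x, hx, rfl⟩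
    rw [SetLike.mem_coe, LinearMap.mem_ker, d_cell]
    exact if_pos hx
  d_d c := by
    suffices (simplicialChains R X).d ∘ₗ (simplicialChains R X).d = 0 from
      LinearMap.congr_fun this c
    refine chains_hom_ext fun x => ?_
    rw [LinearMap.comp_apply, LinearMap.zero_apply, d_cell]
    split_ifs with h0
    · rw [map_zero]
    obtain ⟨n, hn⟩ : ∃ n, x.dim = n + 1 := ⟨x.dim - 1, by omega⟩
    rw [map_sum, hn]
    rcases n with _ | n
    · refine Finset.sum_eq_zero fun i _ => ?_
      rw [map_smul, d_cell, if_pos (by rw [dim_face]; omega), smul_zero]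
    refine Eq.trans (Finset.sum_congr rfl fun i hi => ?_) (sum_sum_alternating_eq_zero (R := R)
      (n + 2) (fun i j => ((x.face i).face j).cell R) ?_)
    · rw [map_smul, d_cell, if_neg (by rw [dim_face]; omega), Finset.smul_sum, dim_face, hn]
      refine Finset.sum_congr rfl fun j _ => ?_
      rw [smul_smul, ← pow_add]
    · intro i j hij hj
      rw [face_face _ _ _ hij (by omega) (by omega)]

theorem coassoc_chains (X : SSet.{u}) :
    (TensorProduct.assoc R (simplicialChains R X).carrier (simplicialChains R X).carrier
        (simplicialChains R X).carrier).toLinearMap ∘ₗ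
      TensorProduct.map (simplicialChains R X).comul .id ∘ₗ (simplicialChains R X).comul =
    TensorProduct.map .id (simplicialChains R X).comul ∘ₗ (simplicialChains R X).comul := by
  refine chains_hom_ext fun x => ?_
  simp only [LinearMap.comp_apply, LinearEquiv.coe_coe, comul_cell, map_sum,
    TensorProduct.map_tmul, LinearMap.id_apply, TensorProduct.sum_tmul, TensorProduct.tmul_sum,
    TensorProduct.assoc_tmul, dim_front, dim_back]
  rw [Finset.sum_sigma', Finset.sum_sigma']
  refine Finset.sum_bij' (fun p _ => ⟨p.2, p.1 - p.2⟩) (fun p _ => ⟨p.1 + p.2, p.1⟩) ?_ ?_ ?_ ?_ ?_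
  · rintro ⟨k, j⟩ h
    simp only [Finset.mem_sigma, Finset.mem_range] at h ⊢
    omega
  · rintro ⟨j, l⟩ h
    simp only [Finset.mem_sigma, Finset.mem_range] at h ⊢
    omega
  · rintro ⟨k, j⟩ h
    simp only [Finset.mem_sigma, Finset.mem_range] at h
    simp only [Sigma.mk.injEq, heq_eq_eq, and_true]
    omega
  · rintro ⟨j, l⟩ h
    simp only [Sigma.mk.injEq, heq_eq_eq, true_and]
    omega
  · rintro ⟨k, j⟩ h
    simp only [Finset.mem_sigma, Finset.mem_range] at h
    simp only
    rw [front_front _ _ _ (by omega), back_front _ _ _ (by omega), back_back _ _ _ (by omega),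
      Nat.add_sub_cancel' (by omega)]

/-- The summands `±∂_k` of the front `k`-face and `±∂_0` of the back face of the right hand side are the
two that do not come from the left hand side; they cancel for neighbouring values of `k`. -/
theorem comul_d_chains (X : SSet.{u}) :
    (simplicialChains R X).comul ∘ₗ (simplicialChains R X).d =
      (TensorProduct.map (simplicialChains R X).d .id +
        TensorProduct.map (simplicialChains R X).sign (simplicialChains R X).d) ∘ₗ
        (simplicialChains R X).comul := by
  refine chains_hom_ext fun x => ?_
  rcases hn : x.dim with _ | n
  · simp [d_cell, comul_cell, hn]
  simp only [LinearMap.comp_apply, LinearMap.add_apply, comul_cell, map_sum,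
    TensorProduct.map_tmul, LinearMap.id_apply, sign_cell, dim_front]
  rw [d_cell, if_neg (by omega), hn, map_sum, Finset.sum_add_distrib, Finset.sum_range_succ' (fun i =>
    (simplicialChains R X).d ((x.front i).cell R) ⊗ₜ[R] (x.back i).cell R),
    Finset.sum_range_succ (fun i =>
    ((-1 : R) ^ i • (x.front i).cell R) ⊗ₜ[R] (simplicialChains R X).d ((x.back i).cell R)),
    d_cell R (x.front 0), if_pos (by rw [dim_front]), d_cell R (x.back (n + 1)),
    if_pos (by rw [dim_back]; omega), TensorProduct.zero_tmul, TensorProduct.tmul_zero, add_zero,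
    add_zero, ← Finset.sum_add_distrib]
  have hL (j : ℕ) (hj : j ∈ Finset.range (n + 1 + 1)) :
      (simplicialChains R X).comul ((-1 : R) ^ j • (x.face j).cell R) =
        ∑ k ∈ Finset.range (n + 1), (-1 : R) ^ j •
          (((x.face j).front k).cell R ⊗ₜ[R] ((x.face j).back k).cell R) := by
    rw [map_smul, comul_cell, Finset.smul_sum, dim_face, hn]
    rfl
  rw [Finset.sum_congr rfl hL, Finset.sum_comm]
  refine Finset.sum_congr rfl fun k hk => ?_
  rw [Finset.mem_range] at hk
  obtain ⟨l, rfl⟩ : ∃ l, n = k + l := ⟨n - k, by omega⟩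
  have e1 : (x.front (k + 1)).face (k + 1) = x.front k := by
    rw [face_last _ k rfl, front_front _ _ _ (by omega)]
  have e2 : (x.back k).face 0 = x.back (k + 1) := by
    rw [face_zero, back_back _ _ _ (by omega)]
  rw [show k + l + 1 + 1 = (k + 1) + (l + 1) by omega, Finset.sum_range_add,
    d_cell R (x.front (k + 1)), if_neg (by simp), d_cell R (x.back k),
    if_neg (by rw [dim_back]; omega), dim_front, dim_back, hn,
    show k + l + 1 - k = l + 1 by omega, Finset.sum_range_succ _ (k + 1),
    Finset.sum_range_succ' _ (l + 1), e1, e2, TensorProduct.add_tmul, TensorProduct.tmul_add]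
  have h1 : ∀ j ∈ Finset.range (k + 1), (-1 : R) ^ j •
      (((x.face j).front k).cell R ⊗ₜ[R] ((x.face j).back k).cell R) =
      ((-1 : R) ^ j • ((x.front (k + 1)).face j).cell R) ⊗ₜ[R] (x.back (k + 1)).cell R := by
    intro j hj
    rw [Finset.mem_range] at hj
    rw [front_face_of_le _ _ _ (by omega) (by omega), back_face_of_le _ _ _ (by omega) (by omega),
      TensorProduct.smul_tmul']
  have h2 : ∀ j ∈ Finset.range (l + 1), (-1 : R) ^ (k + 1 + j) •
      (((x.face (k + 1 + j)).front k).cell R ⊗ₜ[R] ((x.face (k + 1 + j)).back k).cell R) =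
      ((-1 : R) ^ k • (x.front k).cell R) ⊗ₜ[R]
        ((-1 : R) ^ (j + 1) • ((x.back k).face (j + 1)).cell R) := by
    intro j hj
    rw [Finset.mem_range] at hj
    rw [front_face_of_lt _ _ _ (by omega) (by omega), back_face_of_ge _ _ _ (by omega) (by omega),
      TensorProduct.smul_tmul_smul, ← pow_add, show k + 1 + j - k = j + 1 by omega]
    congr 2
    omega
  rw [Finset.sum_congr rfl h1, Finset.sum_congr rfl h2, ← TensorProduct.sum_tmul,
    ← TensorProduct.tmul_sum, pow_succ, mul_neg_one, neg_smul, TensorProduct.neg_tmul, pow_zero,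
    one_smul]
  abel

theorem eq_of_dim_eq_zero (hX : OneReduced X) (x y : Simplex X) (hx : x.dim = 0)
    (hy : y.dim = 0) : x = y := by
  obtain ⟨n, x⟩ := x
  obtain ⟨m, y⟩ := y
  obtain rfl : n = 0 := hx
  obtain rfl : m = 0 := hy
  have := (Nat.card_eq_one_iff_unique.1 hX.1).1
  rw [Subsingleton.elim x y]

theorem eq_of_dim_eq_one (hX : OneReduced X) (x y : Simplex X) (hx : x.dim = 1)
    (hy : y.dim = 1) : x = y := by
  obtain ⟨n, x⟩ := x
  obtain ⟨m, y⟩ := y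
  obtain rfl : n = 1 := hx
  obtain rfl : m = 1 := hy
  have := (Nat.card_eq_one_iff_unique.1 hX.2).1
  rw [Subsingleton.elim x y]

/-- The only 1-simplex of a 1-reduced simplicial set is degenerate. -/
theorem cell_eq_zero_of_dim_eq_one (hX : OneReduced X) (x : Simplex X) (hx : x.dim = 1) :
    x.cell R = 0 := by
  obtain ⟨y⟩ := (Nat.card_eq_one_iff_unique.1 hX.1).2
  rw [eq_of_dim_eq_one hX x (degen 0 ⟨0, y⟩) hx rfl]
  exact cell_degen R ⟨0, y⟩

theorem isOneReducedDGCoalgebra_chains (hX : OneReduced X) :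
    (simplicialChains R X).IsOneReducedDGCoalgebra where
  isChainComplex := isChainComplex_chains R X
  comul_mem n c hc := by
    suffices (simplicialChains R X).gr n ≤ Submodule.comap (simplicialChains R X).comul
      (⨆ p : {p : ℕ × ℕ // p.1 + p.2 = n}, Submodule.map₂ (TensorProduct.mk R _ _)
        ((simplicialChains R X).gr p.1.1) ((simplicialChains R X).gr p.1.2)) from this hc
    rw [gr_eq_span, Submodule.span_le]
    rintro _ ⟨x, hx, rfl⟩
    change x.dim = n at hx
    rw [SetLike.mem_coe, Submodule.mem_comap, comul_cell]
    refine Submodule.sum_mem _ fun i hi => ?_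
    rw [Finset.mem_range] at hi
    exact Submodule.mem_iSup_of_mem ⟨(i, n - i), by simp only; omega⟩
      (Submodule.apply_mem_map₂ _ (cell_mem_gr R rfl) (cell_mem_gr R (by rw [dim_back, hx])))
  comul_d := comul_d_chains R X
  coassoc := coassoc_chains R X
  counit_of_mem n c hc := by
    refine (?_ : (simplicialChains R X).gr (n + 1) ≤
      LinearMap.ker (simplicialChains R X).counit) hc
    rw [gr_eq_span, Submodule.span_le]
    rintro _ ⟨x, hx, rfl⟩
    change x.dim = n + 1 at hx
    rw [SetLike.mem_coe, LinearMap.mem_ker, counit_cell, if_neg (by omega)]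
  counit_comul_left c := by
    refine LinearMap.congr_fun (f := (TensorProduct.lid R _).toLinearMap ∘ₗ
      TensorProduct.map (simplicialChains R X).counit .id ∘ₗ (simplicialChains R X).comul)
      (g := .id) (chains_hom_ext fun x => ?_) c
    simp only [LinearMap.comp_apply, LinearEquiv.coe_coe, comul_cell, map_sum,
      TensorProduct.map_tmul, LinearMap.id_apply, TensorProduct.lid_tmul]
    rw [Finset.sum_eq_single_of_mem 0 (by simp)]
    · rw [counit_cell, if_pos (dim_front 0 x), one_smul, back_zero]
    · intro i _ hi
      rw [counit_cell, if_neg (by rwa [dim_front]), zero_smul]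
  counit_comul_right c := by
    refine LinearMap.congr_fun (f := (TensorProduct.rid R _).toLinearMap ∘ₗ
      TensorProduct.map .id (simplicialChains R X).counit ∘ₗ (simplicialChains R X).comul)
      (g := .id) (chains_hom_ext fun x => ?_) c
    simp only [LinearMap.comp_apply, LinearEquiv.coe_coe, comul_cell, map_sum,
      TensorProduct.map_tmul, LinearMap.id_apply, TensorProduct.rid_tmul]
    rw [Finset.sum_eq_single_of_mem x.dim (by simp)]
    · rw [counit_cell, if_pos (by rw [dim_back]; omega), one_smul, front_self]
    · intro i hi hi'
      rw [Finset.mem_range] at hi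
      rw [counit_cell, if_neg (by rw [dim_back]; omega), zero_smul]
  bijective_counit := by
    obtain ⟨p⟩ := (Nat.card_eq_one_iff_unique.1 hX.1).2
    let e : Simplex X := ⟨0, p⟩
    have he : (simplicialChains R X).counit (e.cell R) = 1 :=
      (counit_cell R e).trans (if_pos rfl)
    have hgr : (simplicialChains R X).gr 0 = Submodule.span R {e.cell R} := by
      rw [gr_eq_span]
      congr 1
      refine Set.Subset.antisymm ?_ ?_
      · rintro _ ⟨x, hx, rfl⟩
        exact congrArg (cell R) (eq_of_dim_eq_zero hX x e hx rfl)
      · rintro _ rfl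
        exact ⟨e, rfl, rfl⟩
    constructor
    · rw [← LinearMap.ker_eq_bot, LinearMap.ker_eq_bot']
      rintro ⟨c, hc⟩ h
      rw [hgr] at hc
      obtain ⟨r, rfl⟩ := Submodule.mem_span_singleton.1 hc
      rw [LinearMap.domRestrict_apply] at h
      simp only [map_smul, he, smul_eq_mul, mul_one] at h
      exact Subtype.ext (by simp [h])
    · intro r
      refine ⟨⟨r • e.cell R, Submodule.smul_mem _ _ (cell_mem_gr R rfl)⟩, ?_⟩
      rw [LinearMap.domRestrict_apply]
      simp [he]
  gr_one := by
    rw [gr_eq_span, eq_bot_iff, Submodule.span_le]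
    rintro _ ⟨x, hx, rfl⟩
    exact cell_eq_zero_of_dim_eq_one R hX x hx

end Simplex

/-! ### Twisted Cartesian products -/

namespace DGCoalgebra

variable {R : Type t} [CommRing R] (C : DGCoalgebra.{v, t} R)

/-- The differential `d ⊗ 1 + 1 ⊗ d + φ ∩ -` of a twisted tensor product, as an endomorphism of the
tensor product of the underlying modules. -/
def twistedD {A : Type*} [AddCommGroup A] [Module R A] (M : DGModule.{w, t} R)
    (act : A →ₗ[R] M.carrier →ₗ[R] M.carrier) (φ : C.carrier →ₗ[R] A) :
    C.carrier ⊗[R] M.carrier →ₗ[R] C.carrier ⊗[R] M.carrier :=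
  TensorProduct.map C.d .id + TensorProduct.map C.sign M.d + C.cap act φ

theorem twistedD_tmul {A : Type*} [AddCommGroup A] [Module R A] (M : DGModule.{w, t} R)
    (act : A →ₗ[R] M.carrier →ₗ[R] M.carrier) (φ : C.carrier →ₗ[R] A) (c : C.carrier)
    (m : M.carrier) : C.twistedD M act φ (c ⊗ₜ m) =
      C.d c ⊗ₜ m + C.sign c ⊗ₜ M.d m + C.cap act φ (c ⊗ₜ m) :=
  rfl

end DGCoalgebra

namespace TruncatingTwistingFunction

variable (R : Type t) [CommRing R] {X : SSet.{u}} {Q : MonoidalCubicalSet.{v}}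
  (τ : TruncatingTwistingFunction X Q)

theorem cochain_cell (x : Simplex X) : τ.cochain R (x.cell R) =
    if 2 ≤ x.dim then -Q.cell R (τ.toFun x) else 0 := by
  dsimp only [cochain, Simplex.cell, CubicalSet.cell]
  exact NormalizedChains.lift_mk (M := NormalizedChains R Q.toCubicalSet.degenerate) _ _ x

theorem cochain_cell_of_le {x : Simplex X} (h : x.dim ≤ 1) : τ.cochain R (x.cell R) = 0 := by
  rw [cochain_cell, if_neg (by omega)]

theorem cochain_cell_of_ge {x : Simplex X} (h : 2 ≤ x.dim) :
    τ.cochain R (x.cell R) = -Q.cell R (τ.toFun x) := by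
  rw [cochain_cell, if_pos h]

end TruncatingTwistingFunction

namespace TwistedProduct

open SemiCubicalSet

variable {R : Type t} [CommRing R] {X : SSet.{u}} {Q : MonoidalCubicalSet.{v}}
  (τ : TruncatingTwistingFunction X Q) (L : CubicalModule.{v, w} Q)

/-- The class of a pair in the chains of the twisted product. -/
def pairCell (z : Simplex X × L.carrier) : ((twistedProduct τ L).chains R).carrier :=
  (toSemiCubicalSet τ L).toCubicalSet.cell R (cube (P := toSemiCubicalSet τ L) z)

theorem pairCell_degen_right (x : Simplex X) (y : L.carrier) (j : ℕ) (hj : j ≤ L.dim y) :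
    pairCell (R := R) τ L (x, L.degen j y) = 0 :=
  cell_of_isDegen (P := toSemiCubicalSet τ L) (PairIsDegen.right x y j hj)
    (Nat.add_le_add_left hj _)

theorem pairCell_degen_left (x : Simplex X) (y : L.carrier) :
    pairCell (R := R) τ L (x.degen x.dim, y) = 0 :=
  cell_of_isDegen (P := toSemiCubicalSet τ L) (PairIsDegen.left x y) (Nat.le_add_right _ _)

variable (R) in
/-- The map `(x, y) ↦ x ⊗ y`. -/
def toTensor : ((twistedProduct τ L).chains R).carrier →ₗ[R]
    (simplicialChains R X).carrier ⊗[R] (L.chains R).carrier :=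
  cubeLift (P := toSemiCubicalSet τ L) (fun z => z.1.cell R ⊗ₜ L.cell R z.2) (by
    rintro k g h (⟨x, y, j, hj⟩ | ⟨x, y⟩) -
    · simp only
      rw [CubicalSet.cell_degen _ _ _ _ hj, TensorProduct.tmul_zero]
    · simp only
      rw [Simplex.cell_degen, TensorProduct.zero_tmul])

theorem toTensor_pairCell (x : Simplex X) (y : L.carrier) :
    toTensor R τ L (pairCell τ L (x, y)) = x.cell R ⊗ₜ L.cell R y :=
  cubeLift_cell _ _ _

variable (R) in
/-- The map `x ⊗ y ↦ (x, y)`. -/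
def ofTensor : (simplicialChains R X).carrier ⊗[R] (L.chains R).carrier →ₗ[R]
    ((twistedProduct τ L).chains R).carrier :=
  TensorProduct.lift (Simplex.chainsLift
    (fun x => L.toCubicalSet.chainsLift (fun y => pairCell τ L (x, y))
      (fun j y hj => pairCell_degen_right τ L x y j hj))
    (fun x => L.toCubicalSet.chains_hom_ext fun y =>
      (L.toCubicalSet.chainsLift_cell _ _ _).trans (pairCell_degen_left τ L x y)))

theorem ofTensor_tmul (x : Simplex X) (y : L.carrier) :
    ofTensor R τ L (x.cell R ⊗ₜ L.cell R y) = pairCell τ L (x, y) := by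
  rw [ofTensor, TensorProduct.lift.tmul, Simplex.chainsLift_cell, CubicalSet.chainsLift_cell]

variable {τ L} in
theorem hom_ext {M : Type*} [AddCommGroup M] [Module R M]
    {f g : ((twistedProduct τ L).chains R).carrier →ₗ[R] M}
    (h : ∀ x y, f (pairCell τ L (x, y)) = g (pairCell τ L (x, y))) : f = g :=
  cube_hom_ext (P := toSemiCubicalSet τ L) fun z => h z.1 z.2

variable {L} in
theorem tensor_hom_ext {M : Type*} [AddCommGroup M] [Module R M]
    {f g : (simplicialChains R X).carrier ⊗[R] (L.chains R).carrier →ₗ[R] M}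
    (h : ∀ x y, f (Simplex.cell R x ⊗ₜ L.cell R y) = g (Simplex.cell R x ⊗ₜ L.cell R y)) :
    f = g :=
  TensorProduct.ext (Simplex.chains_hom_ext fun x => L.toCubicalSet.chains_hom_ext fun y => h x y)

variable (R) in
/-- The isomorphism of modules `(x, y) ↔ x ⊗ y`. -/
def tensorEquiv : ((twistedProduct τ L).chains R).carrier ≃ₗ[R]
    (simplicialChains R X).carrier ⊗[R] (L.chains R).carrier :=
  .ofLinearMap (toTensor R τ L) (ofTensor R τ L)
    (tensor_hom_ext fun x y => by
      rw [LinearMap.comp_apply, ofTensor_tmul, toTensor_pairCell, LinearMap.id_apply])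
    (hom_ext fun x y => by
      rw [LinearMap.comp_apply, toTensor_pairCell, ofTensor_tmul, LinearMap.id_apply])

theorem d_pairCell (x : Simplex X) (y : L.carrier) :
    ((twistedProduct τ L).chains R).d (pairCell τ L (x, y)) =
      ∑ i ∈ Finset.range x.dim, (-1 : R) ^ (i + 1) •
        (pairCell τ L (x.front i, L.act (τ.toFun (x.back i)) y) - pairCell τ L (x.face i, y)) +
      ∑ i ∈ Finset.range (L.dim y), (-1 : R) ^ (x.dim + i + 1) •
        (pairCell τ L (x, L.face false i y) - pairCell τ L (x, L.face true i y)) := by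
  have h : ((twistedProduct τ L).chains R).d (pairCell τ L (x, y)) =
      ∑ i ∈ Finset.range (x.dim + L.dim y), (-1 : R) ^ (i + 1) •
        (pairCell τ L (pairFace τ L false i (x, y)) - pairCell τ L (pairFace τ L true i (x, y))) :=
    chains_d_cube (P := toSemiCubicalSet τ L) (x, y)
  rw [h, Finset.sum_range_add]
  congr 1
  · refine Finset.sum_congr rfl fun i hi => ?_
    rw [Finset.mem_range] at hi
    rw [pairFace_false τ L i x y hi, pairFace_true τ L i x y hi]
  · refine Finset.sum_congr rfl fun i _ => ?_
    rw [pairFace_right τ L false _ i x y rfl, pairFace_right τ L true _ i x y rfl]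

theorem toTensor_d (z : ((twistedProduct τ L).chains R).carrier) :
    toTensor R τ L (((twistedProduct τ L).chains R).d z) =
      (simplicialChains R X).twistedD (L.chains R) (L.chainAct R) (τ.cochain R)
        (toTensor R τ L z) := by
  suffices toTensor R τ L ∘ₗ ((twistedProduct τ L).chains R).d =
      (simplicialChains R X).twistedD (L.chains R) (L.chainAct R) (τ.cochain R) ∘ₗ
        toTensor R τ L from LinearMap.congr_fun this z
  refine hom_ext fun x y => ?_
  rw [LinearMap.comp_apply, LinearMap.comp_apply, toTensor_pairCell, DGCoalgebra.twistedD_tmul,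
    Simplex.cap_cell_tmul,
    d_pairCell, map_add, map_sum, map_sum, CubicalSet.chains_d_cell,
    Simplex.sign_cell, add_right_comm, TensorProduct.tmul_sum]
  simp only [map_smul, map_sub, toTensor_pairCell]
  congr 1
  · rcases hn : x.dim with _ | n
    · simp only [Finset.range_zero, Finset.sum_empty, Simplex.d_cell, hn, if_true,
        TensorProduct.zero_tmul, zero_add, Finset.sum_range_one]
      rw [τ.cochain_cell_of_le R (by simp [hn])]
      simp
    rw [Simplex.d_cell, if_neg (by omega), hn, Finset.sum_range_succ _ (n + 1),
      Finset.sum_range_succ _ (n + 1), Finset.sum_range_succ _ n, Finset.sum_range_succ _ n,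
      Finset.sum_range_succ _ n, τ.cochain_cell_of_le R (x := x.back (n + 1)) (by simp [hn]),
      τ.cochain_cell_of_le R (x := x.back n) (by simp [hn]),
      τ.toFun_one _ (by simp [hn]), L.one_act]
    have h : ∀ i ∈ Finset.range n, (-1 : R) ^ i • (x.front i).cell R ⊗ₜ[R]
        L.chainAct R (τ.cochain R ((x.back i).cell R)) (L.cell R y) =
        (-1 : R) ^ (i + 1) • (x.front i).cell R ⊗ₜ[R]
          L.cell R (L.act (τ.toFun (x.back i)) y) := by
      intro i hi
      rw [Finset.mem_range] at hi
      rw [τ.cochain_cell_of_ge R (by rw [Simplex.dim_back]; omega), map_neg, LinearMap.neg_apply,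
        CubicalModule.chainAct_cell, TensorProduct.tmul_neg, smul_neg, pow_succ, mul_neg_one, neg_smul]
    -- the last summand of `∂ x` is the summand of `d⁰` with a 1-dimensional back face
    rw [Finset.sum_congr rfl h, Simplex.face_last x n hn]
    simp only [smul_sub, Finset.sum_sub_distrib, TensorProduct.add_tmul, TensorProduct.sum_tmul,
      TensorProduct.smul_tmul', map_zero, LinearMap.zero_apply, TensorProduct.tmul_zero, smul_zero,
      pow_succ, mul_neg_one, neg_smul, Finset.sum_neg_distrib, TensorProduct.neg_tmul]
    abel
  · refine Finset.sum_congr rfl fun i _ => ?_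
    rw [TensorProduct.smul_tmul_smul, ← pow_add, TensorProduct.tmul_sub, add_assoc]

theorem map_toTensor_gr (n : ℕ) : (((twistedProduct τ L).chains R).gr n).map (toTensor R τ L) =
    ⨆ p : {p : ℕ × ℕ // p.1 + p.2 = n}, Submodule.map₂
      (TensorProduct.mk R (simplicialChains R X).carrier (L.chains R).carrier)
      ((simplicialChains R X).gr p.1.1) ((L.chains R).gr p.1.2) := by
  have e := chains_gr_eq_span_cube R (P := toSemiCubicalSet τ L) n
  refine (congrArg (Submodule.map (toTensor R τ L)) e).trans ?_
  refine (Submodule.map_span _ _).trans (le_antisymm (Submodule.span_le.2 ?_) (iSup_le ?_))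
  · rintro _ ⟨_, ⟨⟨x, y⟩, h, rfl⟩, rfl⟩
    refine Submodule.mem_iSup_of_mem ⟨(x.dim, L.dim y), h⟩ ?_
    refine (congrArg (· ∈ _) (toTensor_pairCell τ L x y)).mpr ?_
    exact Submodule.apply_mem_map₂ _ (Simplex.cell_mem_gr R rfl) (CubicalSet.cell_mem_gr R _ rfl)
  · rintro ⟨⟨p, q⟩, h⟩
    simp only at h ⊢
    rw [Simplex.gr_eq_span, CubicalSet.chains_gr, Submodule.map₂_span_span, Submodule.span_le]
    rintro _ ⟨_, ⟨x, hx, rfl⟩, _, ⟨y, hy, rfl⟩, rfl⟩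
    change x.dim = p at hx
    change L.dim y = q at hy
    subst hx hy
    exact Submodule.subset_span ⟨_, ⟨(x, y), h, rfl⟩, toTensor_pairCell τ L x y⟩

end TwistedProduct

namespace TwistedProduct

variable (R : Type t) [CommRing R] {X : SSet.{u}} {Q : MonoidalCubicalSet.{v}}
  (τ : TruncatingTwistingFunction X Q) (L : CubicalModule.{v, w} Q)

theorem isIso_tensorEquiv : DGModule.IsIso (C := (twistedProduct τ L).chains R)
    (D := (simplicialChains R X).twistedTensor (L.chains R) (L.chainAct R) (τ.cochain R))
    (tensorEquiv R τ L) :=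
  ⟨map_toTensor_gr τ L, toTensor_d τ L⟩

end TwistedProduct

/-! ### Twisting cochains -/

namespace MonoidalCubicalSet

variable (R : Type t) [CommRing R] (Q : MonoidalCubicalSet.{v})

/-- The multiplication of the chains of a monoidal cubical set. -/
def chainMul : (Q.chains R).carrier →ₗ[R] (Q.chains R).carrier →ₗ[R] (Q.chains R).carrier :=
  Q.selfModule.chainAct R

theorem chainMul_cell (a b : Q.carrier) :
    Q.chainMul R (Q.cell R a) (Q.cell R b) = Q.cell R (Q.mul a b) :=
  Q.selfModule.chainAct_cell R a b

theorem d_chainMul_cell (a : Q.carrier) (z : (Q.chains R).carrier) :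
    (Q.chains R).d (Q.chainMul R (Q.cell R a) z) =
      Q.chainMul R ((Q.chains R).d (Q.cell R a)) z +
        (-1 : R) ^ Q.dim a • Q.chainMul R (Q.cell R a) ((Q.chains R).d z) :=
  Q.selfModule.d_chainAct_cell R a z

end MonoidalCubicalSet

namespace TruncatingTwistingFunction

variable (R : Type t) [CommRing R] {X : SSet.{u}} {Q : MonoidalCubicalSet.{v}}
  (τ : TruncatingTwistingFunction X Q)

/-- In Brown's condition, the summands with a factor `τ(y) = e` on the one side and the first and
the last summand of the simplicial differential on the other are what cancels. -/
theorem brown_cochain : (Q.chains R).d ∘ₗ τ.cochain R + τ.cochain R ∘ₗ (simplicialChains R X).d =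
    -(TensorProduct.lift (Q.chainMul R) ∘ₗ
      TensorProduct.map (τ.cochain R ∘ₗ (simplicialChains R X).sign) (τ.cochain R) ∘ₗ
      (simplicialChains R X).comul) := by
  refine Simplex.chains_hom_ext fun x => ?_
  simp only [LinearMap.add_apply, LinearMap.neg_apply, LinearMap.comp_apply, Simplex.comul_cell,
    map_sum, TensorProduct.map_tmul, TensorProduct.lift.tmul, Simplex.sign_cell, map_smul,
    LinearMap.smul_apply, Simplex.dim_front]
  have hd : τ.cochain R ((simplicialChains R X).d (x.cell R)) = if x.dim = 0 then 0 else
      ∑ i ∈ Finset.range (x.dim + 1), (-1 : R) ^ i • τ.cochain R ((x.face i).cell R) := by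
    rw [Simplex.d_cell]
    split_ifs
    · rw [map_zero]
    · rw [map_sum]
      exact Finset.sum_congr rfl fun i _ => map_smul _ _ _
  rw [hd]
  have hone {y : Simplex X} (hy : y.dim ≤ 1) := τ.cochain_cell_of_le R hy
  rcases le_or_gt x.dim 2 with h2 | h2
  · -- `τ_*` vanishes in dimensions at most `1`, which leaves `d (τ_* x)` for a 2-simplex `x`;
    -- this is zero because both faces of `τ(x)` are the unit
    have hr : ∑ i ∈ Finset.range (x.dim + 1), (-1 : R) ^ i • Q.chainMul R
        (τ.cochain R ((x.front i).cell R)) (τ.cochain R ((x.back i).cell R)) = 0 := by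
      refine Finset.sum_eq_zero fun i _ => ?_
      rcases le_or_gt i 1 with hi | hi
      · rw [hone (y := x.front i) hi, map_zero, LinearMap.zero_apply, smul_zero]
      · rw [hone (y := x.back i) (by rw [Simplex.dim_back]; omega), map_zero, smul_zero]
    have hl : ∑ i ∈ Finset.range (x.dim + 1), (-1 : R) ^ i • τ.cochain R ((x.face i).cell R) = 0 :=
      Finset.sum_eq_zero fun i _ => by
        rw [hone (y := x.face i) (by rw [Simplex.dim_face]; omega), smul_zero]
    rw [hr, hl, ite_self, neg_zero, add_zero]
    rcases lt_or_eq_of_le h2 with h | h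
    · rw [hone (y := x) (by omega), map_zero]
    · have hQ := τ.dim_toFun x (by omega)
      rw [τ.cochain_cell_of_ge R h.ge, map_neg, CubicalSet.chains_d_cell,
        show Q.dim (τ.toFun x) = 1 by omega, Finset.sum_range_one, τ.face_false _ _ (by omega),
        τ.face_true _ _ (by omega), τ.toFun_one (x.front _) rfl, τ.toFun_one (x.back _)
        (by rw [Simplex.dim_back]; omega), τ.toFun_one (x.face _)
        (by rw [Simplex.dim_face]; omega), Q.one_mul, sub_self, smul_zero, neg_zero]
  · obtain ⟨m, hm⟩ : ∃ m, x.dim = m + 3 := ⟨x.dim - 3, by omega⟩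
    have hQ := τ.dim_toFun x (by omega)
    let P (j : ℕ) : (Q.chains R).carrier :=
      Q.cell R (Q.mul (τ.toFun (x.front j)) (τ.toFun (x.back j)))
    let S (j : ℕ) : (Q.chains R).carrier := Q.cell R (τ.toFun (x.face j))
    have h1 : (Q.chains R).d (τ.cochain R (x.cell R)) =
        -∑ i ∈ Finset.range (m + 2), (-1 : R) ^ (i + 1) • (P (i + 1) - S (i + 1)) := by
      rw [τ.cochain_cell_of_ge R (by omega), map_neg, CubicalSet.chains_d_cell,
        show Q.dim (τ.toFun x) = m + 2 by omega]
      refine congrArg Neg.neg (Finset.sum_congr rfl fun i hi => ?_)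
      rw [Finset.mem_range] at hi
      rw [τ.face_false _ _ (by omega), τ.face_true _ _ (by omega)]
    have h3 : ∀ i ∈ Finset.range (m + 4), (-1 : R) ^ i • τ.cochain R ((x.face i).cell R) =
        -((-1 : R) ^ i • S i) := fun i _ => by
      rw [τ.cochain_cell_of_ge R (by rw [Simplex.dim_face]; omega), smul_neg]
    have h4 : ∀ i ∈ Finset.range m, (-1 : R) ^ (i + 1 + 1) • Q.chainMul R
        (τ.cochain R ((x.front (i + 1 + 1)).cell R)) (τ.cochain R ((x.back (i + 1 + 1)).cell R)) =
        (-1 : R) ^ (i + 1 + 1) • P (i + 1 + 1) := fun i hi => by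
      rw [Finset.mem_range] at hi
      rw [τ.cochain_cell_of_ge R (by rw [Simplex.dim_front]; omega),
        τ.cochain_cell_of_ge R (by rw [Simplex.dim_back]; omega), map_neg, map_neg,
        LinearMap.neg_apply, neg_neg, MonoidalCubicalSet.chainMul_cell]
    have hP1 : P 1 = S 0 := by
      simp only [P, S]
      rw [τ.toFun_one (x.front 1) rfl, Q.one_mul, Simplex.face_zero]
    have hP2 : P (m + 2) = S (m + 3) := by
      simp only [P, S]
      rw [τ.toFun_one (x.back (m + 2)) (by rw [Simplex.dim_back]; omega), Q.mul_one,
        Simplex.face_last x (m + 2) hm]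
    have hR : ∑ i ∈ Finset.range (m + 4), (-1 : R) ^ i • Q.chainMul R
        (τ.cochain R ((x.front i).cell R)) (τ.cochain R ((x.back i).cell R)) =
        ∑ i ∈ Finset.range m, (-1 : R) ^ (i + 1 + 1) • P (i + 1 + 1) := by
      rw [Finset.sum_range_succ _ (m + 3), Finset.sum_range_succ' _ (m + 2),
        Finset.sum_range_succ' _ (m + 1), Finset.sum_range_succ _ m,
        hone (y := x.front 0) (by simp), hone (y := x.front (0 + 1)) (by simp),
        hone (y := x.back (m + 3)) (by rw [Simplex.dim_back]; omega),
        hone (y := x.back (m + 1 + 1)) (by rw [Simplex.dim_back]; omega), Finset.sum_congr rfl h4]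
      simp only [map_zero, LinearMap.zero_apply, smul_zero, add_zero]
    rw [h1, hm, if_neg (by omega), show m + 3 + 1 = m + 4 by rfl, Finset.sum_congr rfl h3, hR,
      Finset.sum_range_succ _ (m + 3), Finset.sum_range_succ' _ (m + 2)]
    simp only [smul_sub, Finset.sum_sub_distrib, Finset.sum_neg_distrib]
    rw [Finset.sum_range_succ' (fun i => (-1 : R) ^ (i + 1) • P (i + 1)) (m + 1),
      Finset.sum_range_succ (fun i => (-1 : R) ^ (i + 1 + 1) • P (i + 1 + 1)) m,
      show P (0 + 1) = S 0 from hP1, show P (m + 1 + 1) = S (m + 3) from hP2]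
    simp only [pow_succ, mul_neg_one, neg_neg, pow_zero, neg_smul, zero_add]
    abel

theorem isTwistingCochain_cochain : (simplicialChains R X).IsTwistingCochain (Q.chains R)
    (Q.chainMul R) (τ.cochain R) where
  map_mem n c hc := by
    suffices (simplicialChains R X).gr (n + 1) ≤ ((Q.chains R).gr n).comap (τ.cochain R) from
      this hc
    rw [Simplex.gr_eq_span, Submodule.span_le]
    rintro _ ⟨x, hx, rfl⟩
    change x.dim = n + 1 at hx
    rw [SetLike.mem_coe, Submodule.mem_comap, cochain_cell]
    split_ifs with h
    · have := τ.dim_toFun x (by omega)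
      exact Submodule.neg_mem _ (CubicalSet.cell_mem_gr R _ (by omega))
    · exact Submodule.zero_mem _
  map_eq_zero c hc := by
    suffices (simplicialChains R X).gr 0 ≤ LinearMap.ker (τ.cochain R) from this hc
    rw [Simplex.gr_eq_span, Submodule.span_le]
    rintro _ ⟨x, hx, rfl⟩
    change x.dim = 0 at hx
    exact τ.cochain_cell_of_le R (by omega)
  brown := τ.brown_cochain R

end TruncatingTwistingFunction

/-! ### The cubical loop set and the cobar construction -/

namespace DGCoalgebra

variable {R : Type t} [CommRing R] (C : DGCoalgebra.{v, t} R)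

theorem cobarD_one : C.cobarD 1 = 0 := by
  have h := C.cobarD_mul 1 1
  rw [map_one C.cobarSign, mul_one, mul_one, one_mul] at h
  exact left_eq_add.1 h

theorem letter_of_mem_zero (c : C.carrier) (hc : c ∈ C.gr 0) : C.letter c = 0 := by
  rw [letter, LinearMap.comp_apply, toPositive_of_mem_zero _ _ hc, map_zero]

theorem cobarD_letter (n : ℕ) (c : C.carrier) (hc : c ∈ C.gr (n + 1)) :
    C.cobarD (C.letter c) = C.cobarLetterD c := by
  rw [letter, LinearMap.comp_apply, cobarD_ι, toPositive_of_mem _ _ _ hc]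

theorem cobarSign_letter (n : ℕ) (c : C.carrier) (hc : c ∈ C.gr (n + 1)) :
    C.cobarSign (C.letter c) = (-1 : R) ^ n • C.letter c := by
  have h : C.cobarSign (C.letter c) = -C.letter (C.sign (C.toPositive c : C.carrier)) :=
    TensorAlgebra.lift_ι_apply _ _
  rw [h, toPositive_of_mem _ _ _ hc, sign_of_mem _ _ _ hc, map_smul, pow_succ, mul_neg_one,
    neg_smul, neg_neg]

end DGCoalgebra

namespace Simplex

variable (R : Type t) [CommRing R] {X : SSet.{u}}

theorem letter_cell_of_le (hX : OneReduced X) {x : Simplex X} (h : x.dim ≤ 1) :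
    (simplicialChains R X).letter (x.cell R) = 0 := by
  rcases Nat.le_one_iff_eq_zero_or_eq_one.1 h with h | h
  · exact DGCoalgebra.letter_of_mem_zero _ _ (cell_mem_gr R h)
  · rw [cell_eq_zero_of_dim_eq_one R hX x h, map_zero]

end Simplex

namespace LoopWord

variable (R : Type t) [CommRing R] {X : SSet.{u}}

/-- The product `[x̄_1|…|x̄_k]` in the cobar construction given by a word. -/
def letters (w : LoopWord X) : (simplicialChains R X).CobarAlgebra :=
  (w.map fun x => (simplicialChains R X).letter (x.1.cell R)).prod

theorem letters_append (v w : LoopWord X) : letters R (v ++ w) = letters R v * letters R w := by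
  simp [letters]

theorem letters_cons (x : {x : Simplex X // 2 ≤ x.dim}) (w : LoopWord X) :
    letters R (x :: w) = (simplicialChains R X).letter (x.1.cell R) * letters R w :=
  List.prod_cons

theorem letters_bar {x : Simplex X} (h : 2 ≤ x.dim) :
    letters R (bar x) = (simplicialChains R X).letter (x.cell R) := by
  simp [letters, bar, h]

end LoopWord

namespace LoopSet

open SemiCubicalSet LoopWord

variable (R : Type t) [CommRing R] {X : SSet.{u}}

/-- The class of a word in the chains of the cubical loop set. -/
def wordCell (w : LoopWord X) : ((cubicalLoops X).chains R).carrier :=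
  (cubicalLoops X).cell R (cube (P := toSemiCubicalSet X) w)

variable {R} in
theorem hom_ext {M : Type w} [AddCommGroup M] [Module R M]
    {f g : ((cubicalLoops X).chains R).carrier →ₗ[R] M}
    (h : ∀ w, f (wordCell R w) = g (wordCell R w)) : f = g :=
  cube_hom_ext (P := toSemiCubicalSet X) h

theorem wordCell_append (v w : LoopWord X) : wordCell R (v ++ w) =
    (cubicalLoops X).chainMul R (wordCell R v) (wordCell R w) := by
  have h : cube (P := toSemiCubicalSet X) (conc v w) = (cubicalLoops X).mul
      (cube (P := toSemiCubicalSet X) v) (cube (P := toSemiCubicalSet X) w) := by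
    refine congrArg (Quot.mk _) (Subtype.ext (Prod.ext rfl ?_))
    exact (congrArg (List.replicate · true) (dim_conc v w)).trans
      List.replicate_append_replicate.symm
  refine Eq.trans ?_ (MonoidalCubicalSet.chainMul_cell R _ _ _).symm
  rw [← h]
  rfl

theorem wordCell_nil : wordCell R ([] : LoopWord X) = (cubicalLoops X).cell R (cubicalLoops X).one :=
  rfl

theorem wordCell_bar (x : Simplex X) : wordCell R (bar x) =
    (cubicalLoops X).cell R ((universalTwistingFunction X).toFun x) :=
  rfl

theorem cons_eq_bar_append (x : {x : Simplex X // 2 ≤ x.dim}) (w : LoopWord X) :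
    (x :: w : LoopWord X) = bar x.1 ++ w := by
  simp [bar, x.2]

variable (X) in
/-- The linear map `C_*^□(𝛀X) → Ω C_*(X)` with `x̄_1 ⋯ x̄_k ↦ [x̄_1|…|x̄_k]`. -/
def toCobar : ((cubicalLoops X).chains R).carrier →ₗ[R] (simplicialChains R X).CobarAlgebra :=
  cubeLift (P := toSemiCubicalSet X) (letters R) (by
    rintro k g h ⟨u, v, x, hx⟩ -
    rw [letters_append, letters_append, letters_bar R (by rw [Simplex.dim_degen]; omega),
      Simplex.cell_degen, map_zero, zero_mul, mul_zero])

theorem toCobar_wordCell (w : LoopWord X) : toCobar R X (wordCell R w) = letters R w :=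
  cubeLift_cell (P := toSemiCubicalSet X) _ _ w

theorem toCobar_chainMul (a b : ((cubicalLoops X).chains R).carrier) :
    toCobar R X ((cubicalLoops X).chainMul R a b) = toCobar R X a * toCobar R X b := by
  suffices ((cubicalLoops X).chainMul R).compr₂ (toCobar R X) =
      (LinearMap.mul R (simplicialChains R X).CobarAlgebra).compl₁₂ (toCobar R X) (toCobar R X) from
    LinearMap.congr_fun₂ this a b
  refine hom_ext fun v => hom_ext fun w => ?_
  rw [LinearMap.compr₂_apply, LinearMap.compl₁₂_apply, LinearMap.mul_apply', ← wordCell_append,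
    toCobar_wordCell, toCobar_wordCell, toCobar_wordCell, letters_append]

/-- The universal twisting cochain of a coalgebra of chains corresponds to the twisting cochain of
the universal truncating twisting function. -/
theorem toCobar_cochain (hX : OneReduced X) : toCobar R X ∘ₗ
    (universalTwistingFunction X).cochain R = -(simplicialChains R X).letter := by
  refine Simplex.chains_hom_ext fun x => ?_
  rw [LinearMap.comp_apply, LinearMap.neg_apply]
  rcases le_or_gt x.dim 1 with h | h
  · rw [TruncatingTwistingFunction.cochain_cell_of_le _ _ h, map_zero,
      Simplex.letter_cell_of_le R hX h, neg_zero]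
  · rw [TruncatingTwistingFunction.cochain_cell_of_ge _ _ h, map_neg, ← wordCell_bar,
      toCobar_wordCell, letters_bar R h]

/-- The action of the cobar construction on the chains of the loop set by which `[x̄]` acts as the
multiplication by `x̄`. -/
def cobarAction (X : SSet.{u}) : (simplicialChains R X).CobarAlgebra →ₐ[R]
    Module.End R ((cubicalLoops X).chains R).carrier :=
  TensorAlgebra.lift R ((cubicalLoops X).chainMul R ∘ₗ
    (-(universalTwistingFunction X).cochain R) ∘ₗ (simplicialChains R X).positive.subtype)

theorem cobarAction_ι (c : (simplicialChains R X).positive)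
    (z : ((cubicalLoops X).chains R).carrier) : cobarAction R X (TensorAlgebra.ι R c) z =
      (cubicalLoops X).chainMul R (-(universalTwistingFunction X).cochain R c) z := by
  rw [cobarAction, TensorAlgebra.lift_ι_apply]
  rfl

theorem toCobar_cobarAction (hX : OneReduced X) (a : (simplicialChains R X).CobarAlgebra)
    (z : ((cubicalLoops X).chains R).carrier) :
    toCobar R X (cobarAction R X a z) = a * toCobar R X z := by
  induction a using TensorAlgebra.induction generalizing z with
  | algebraMap r =>
    rw [AlgHom.commutes, Module.algebraMap_end_apply, map_smul, Algebra.smul_def]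
  | ι c =>
    have h := LinearMap.congr_fun (toCobar_cochain R hX) (c : (simplicialChains R X).carrier)
    rw [LinearMap.comp_apply, LinearMap.neg_apply] at h
    rw [cobarAction_ι, toCobar_chainMul, map_neg, h, neg_neg, DGCoalgebra.ι_eq_letter]
  | mul a b ha hb => rw [map_mul, Module.End.mul_apply, ha, hb, mul_assoc]
  | add a b ha hb => rw [map_add, LinearMap.add_apply, map_add, ha, hb, add_mul]

theorem cobarAction_letters (v w : LoopWord X) :
    cobarAction R X (letters R v) (wordCell R w) = wordCell R (v ++ w) := by
  induction v with
  | nil => rw [letters, List.map_nil, List.prod_nil, map_one]; rfl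
  | cons x v ih =>
    have hx : ((simplicialChains R X).toPositive (x.1.cell R) : (simplicialChains R X).carrier) =
        x.1.cell R :=
      DGCoalgebra.toPositive_of_mem _ (x.1.dim - 1) _ (Simplex.cell_mem_gr R (by have := x.2; omega))
    rw [letters_cons, map_mul, Module.End.mul_apply, ih, DGCoalgebra.letter, LinearMap.comp_apply,
      cobarAction_ι, hx, TruncatingTwistingFunction.cochain_cell_of_ge _ _ x.2, neg_neg,
      List.cons_append, cons_eq_bar_append, wordCell_append R (bar x.1), wordCell_bar]

/-- The isomorphism of modules `C_*^□(𝛀X) ≃ Ω C_*(X)`. -/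
def cobarEquiv (hX : OneReduced X) : ((cubicalLoops X).chains R).carrier ≃ₗ[R]
    (simplicialChains R X).CobarAlgebra :=
  .ofLinearMap (toCobar R X) ((cobarAction R X).toLinearMap.flip (wordCell R []))
    (LinearMap.ext fun a => by
      refine (toCobar_cobarAction R hX a _).trans ?_
      rw [toCobar_wordCell]
      exact mul_one a)
    (hom_ext fun w => by
      rw [LinearMap.comp_apply, toCobar_wordCell]
      refine (cobarAction_letters R w []).trans ?_
      rw [List.append_nil, LinearMap.id_apply])

/-- Brown's condition for the cochain of the universal truncating twisting function is the formula
for the differential of the letters. -/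
theorem toCobar_brown (hX : OneReduced X) (c : (simplicialChains R X).carrier) :
    toCobar R X (((cubicalLoops X).chains R).d ((universalTwistingFunction X).cochain R c)) =
      -(simplicialChains R X).cobarLetterD c := by
  have h := congrArg (toCobar R X) (LinearMap.congr_fun
    ((universalTwistingFunction X).brown_cochain R) c)
  have hm : toCobar R X ∘ₗ TensorProduct.lift ((cubicalLoops X).chainMul R) ∘ₗ
      TensorProduct.map ((universalTwistingFunction X).cochain R ∘ₗ (simplicialChains R X).sign)
        ((universalTwistingFunction X).cochain R) =
      LinearMap.mul' R _ ∘ₗ TensorProduct.map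
        ((simplicialChains R X).letter ∘ₗ (simplicialChains R X).sign)
        (simplicialChains R X).letter := by
    refine TensorProduct.ext' fun a b => ?_
    have h1 := LinearMap.congr_fun (toCobar_cochain R hX) ((simplicialChains R X).sign a)
    have h2 := LinearMap.congr_fun (toCobar_cochain R hX) b
    rw [LinearMap.comp_apply, LinearMap.neg_apply] at h1 h2
    simp only [LinearMap.comp_apply, TensorProduct.map_tmul, TensorProduct.lift.tmul,
      toCobar_chainMul, h1, h2, neg_mul_neg, LinearMap.mul'_apply]
  have hc := LinearMap.congr_fun (toCobar_cochain R hX) ((simplicialChains R X).d c)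
  have hm' := LinearMap.congr_fun hm ((simplicialChains R X).comul c)
  simp only [LinearMap.comp_apply, LinearMap.neg_apply, LinearMap.add_apply, map_add, map_neg]
    at h hc hm'
  rw [hc, hm'] at h
  simp only [DGCoalgebra.cobarLetterD, LinearMap.comp_apply, LinearMap.neg_apply,
    LinearMap.add_apply]
  rw [← sub_eq_add_neg, sub_eq_iff_eq_add] at h
  rw [h]
  abel

theorem toCobar_d (hX : OneReduced X) (z : ((cubicalLoops X).chains R).carrier) :
    toCobar R X (((cubicalLoops X).chains R).d z) =
      (simplicialChains R X).cobarD (toCobar R X z) := by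
  suffices toCobar R X ∘ₗ ((cubicalLoops X).chains R).d =
      (simplicialChains R X).cobarD ∘ₗ toCobar R X from LinearMap.congr_fun this z
  refine hom_ext fun w => ?_
  rw [LinearMap.comp_apply, LinearMap.comp_apply]
  induction w with
  | nil =>
    rw [toCobar_wordCell, wordCell_nil, CubicalSet.chains_d_cell, (cubicalLoops X).dim_one,
      Finset.sum_range_zero, map_zero]
    exact (DGCoalgebra.cobarD_one _).symm
  | cons x w ih =>
    obtain ⟨x, hx⟩ := x
    have hmem : x.cell R ∈ (simplicialChains R X).gr (x.dim - 1 + 1) :=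
      Simplex.cell_mem_gr R (by omega)
    have hdim : (cubicalLoops X).dim ((universalTwistingFunction X).toFun x) = x.dim - 1 := by
      have := (universalTwistingFunction X).dim_toFun x (by omega); omega
    have hb := toCobar_brown R hX (x.cell R)
    rw [TruncatingTwistingFunction.cochain_cell_of_ge _ _ hx, map_neg, map_neg, neg_inj] at hb
    rw [cons_eq_bar_append, wordCell_append, toCobar_chainMul, DGCoalgebra.cobarD_mul, ← ih,
      toCobar_wordCell R (bar x), letters_bar R hx, wordCell_bar,
      MonoidalCubicalSet.d_chainMul_cell, map_add, map_smul, toCobar_chainMul, toCobar_chainMul, hb,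
      DGCoalgebra.cobarD_letter _ _ _ hmem, DGCoalgebra.cobarSign_letter _ _ _ hmem,
      ← wordCell_bar, toCobar_wordCell R (bar x), letters_bar R hx, hdim, smul_mul_assoc]

theorem letter_mem_span_letters (hX : OneReduced X) (n : ℕ) (c : (simplicialChains R X).carrier)
    (hc : c ∈ (simplicialChains R X).gr (n + 1)) : (simplicialChains R X).letter c ∈
      Submodule.span R (letters R '' {w : LoopWord X | LoopWord.dim w = n}) := by
  suffices (simplicialChains R X).gr (n + 1) ≤ (Submodule.span R (letters R ''
    {w : LoopWord X | LoopWord.dim w = n})).comap (simplicialChains R X).letter from this hc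
  rw [Simplex.gr_eq_span, Submodule.span_le]
  rintro _ ⟨x, hx, rfl⟩
  change x.dim = n + 1 at hx
  rw [SetLike.mem_coe, Submodule.mem_comap]
  rcases le_or_gt x.dim 1 with h | h
  · rw [Simplex.letter_cell_of_le R hX h]
    exact Submodule.zero_mem _
  · rw [← letters_bar R h]
    exact Submodule.subset_span ⟨bar x, by simp [hx], rfl⟩

theorem span_letters_eq_cobar_gr (hX : OneReduced X) (n : ℕ) :
    Submodule.span R (letters R '' {w : LoopWord X | LoopWord.dim w = n}) =
      (simplicialChains R X).cobar.gr n := by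
  refine le_antisymm (Submodule.span_mono ?_) (Submodule.span_le.2 ?_)
  · rintro _ ⟨w, rfl, rfl⟩
    refine ⟨w.map fun x => ⟨x.1.dim - 1, x.1.cell R,
      Simplex.cell_mem_gr R (by have := x.2; omega)⟩, ?_, ?_⟩
    · rw [List.map_map]
      induction w with
      | nil => rfl
      | cons x w ih => rw [List.map_cons, List.sum_cons, ih]; rfl
    · rw [List.map_map]
      rfl
  · rintro _ ⟨l, rfl, rfl⟩
    induction l with
    | nil => exact Submodule.subset_span ⟨[], rfl, rfl⟩
    | cons c l ih =>
      rw [List.map_cons, List.map_cons, List.prod_cons, List.sum_cons]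
      have h := Submodule.mul_mem_mul (letter_mem_span_letters R hX c.1 c.2 c.2.2) ih
      rw [Submodule.span_mul_span] at h
      refine Submodule.span_mono ?_ h
      rintro _ ⟨_, ⟨v, hv, rfl⟩, _, ⟨w, hw, rfl⟩, rfl⟩
      exact ⟨v ++ w, (dim_append v w).trans (congrArg₂ (· + ·) hv hw), letters_append R v w⟩

theorem map_toCobar_gr (hX : OneReduced X) (n : ℕ) :
    (((cubicalLoops X).chains R).gr n).map (toCobar R X) = (simplicialChains R X).cobar.gr n := by
  have e := chains_gr_eq_span_cube R (P := toSemiCubicalSet X) n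
  rw [← span_letters_eq_cobar_gr R hX]
  refine (congrArg (Submodule.map (toCobar R X)) e).trans ((Submodule.map_span _ _).trans ?_)
  congr 1
  refine (Set.image_image _ _ _).trans (Set.image_congr fun w _ => ?_)
  exact toCobar_wordCell R w

theorem isIso_cobarEquiv (hX : OneReduced X) : DGModule.IsIso (C := (cubicalLoops X).chains R)
    (D := (simplicialChains R X).cobar) (cobarEquiv R hX) :=
  ⟨map_toCobar_gr R hX, toCobar_d R hX⟩

theorem isTwistingCochain_universalCochain (hX : OneReduced X) :
    (simplicialChains R X).IsTwistingCochain (simplicialChains R X).cobar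
      (simplicialChains R X).cobarMul (simplicialChains R X).universalCochain where
  map_mem n c hc := by
    refine Submodule.neg_mem _ ?_
    rw [← span_letters_eq_cobar_gr R hX]
    exact letter_mem_span_letters R hX n c hc
  map_eq_zero c hc := neg_eq_zero.2 (DGCoalgebra.letter_of_mem_zero _ c hc)
  brown := by
    refine LinearMap.ext fun c => ?_
    have h := toCobar_brown R hX c
    rw [toCobar_d R hX] at h
    have hc := LinearMap.congr_fun (toCobar_cochain R hX) c
    rw [LinearMap.comp_apply, LinearMap.neg_apply] at hc
    rw [hc] at h
    have hm : TensorProduct.lift (simplicialChains R X).cobarMul ∘ₗ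
        TensorProduct.map ((simplicialChains R X).universalCochain ∘ₗ (simplicialChains R X).sign)
          (simplicialChains R X).universalCochain =
        LinearMap.mul' R (simplicialChains R X).CobarAlgebra ∘ₗ TensorProduct.map
          ((simplicialChains R X).letter ∘ₗ (simplicialChains R X).sign)
          (simplicialChains R X).letter :=
      TensorProduct.ext' fun a b => neg_mul_neg
        ((simplicialChains R X).letter ((simplicialChains R X).sign a)) ((simplicialChains R X).letter b)
    have hm' := LinearMap.congr_fun hm ((simplicialChains R X).comul c)
    change (simplicialChains R X).cobarD (-(simplicialChains R X).letter c) +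
      -(simplicialChains R X).letter ((simplicialChains R X).d c) = -_
    rw [h]
    refine Eq.trans ?_ (congrArg Neg.neg hm').symm
    simp only [DGCoalgebra.cobarLetterD, LinearMap.comp_apply, LinearMap.neg_apply,
      LinearMap.add_apply]
    abel

end LoopSet

/-! ### The cubical path set and the acyclic cobar construction -/

namespace DGCoalgebra

variable {R : Type t} [CommRing R] (C : DGCoalgebra.{v, t} R) {A B : Type*} [AddCommGroup A]
  [Module R A] [AddCommGroup B] [Module R B] {M : DGModule.{u, t} R} {N : DGModule.{w, t} R}
  {act : A →ₗ[R] M.carrier →ₗ[R] M.carrier} {act' : B →ₗ[R] N.carrier →ₗ[R] N.carrier}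
  {φ : C.carrier →ₗ[R] A} {ψ : C.carrier →ₗ[R] B}

theorem lTensor_cap (f : M.carrier →ₗ[R] N.carrier)
    (h : ∀ c m, f (act (φ c) m) = act' (ψ c) (f m)) (z : C.carrier ⊗[R] M.carrier) :
    TensorProduct.map .id f (C.cap act φ z) = C.cap act' ψ (TensorProduct.map .id f z) := by
  induction z with
  | zero => simp only [map_zero]
  | add a b ha hb => simp only [map_add, ha, hb]
  | tmul c m =>
    simp only [cap, LinearMap.comp_apply, TensorProduct.map_tmul, LinearMap.id_apply,
      LinearEquiv.coe_coe]
    induction C.comul c with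
    | zero => simp only [map_zero, TensorProduct.zero_tmul]
    | add a b ha hb => simp only [map_add, TensorProduct.add_tmul, ha, hb]
    | tmul a b =>
      simp only [TensorProduct.map_tmul, TensorProduct.assoc_tmul, TensorProduct.lift.tmul,
        LinearMap.id_apply, h]

theorem lTensor_twistedD (f : M.carrier →ₗ[R] N.carrier) (hd : ∀ m, f (M.d m) = N.d (f m))
    (h : ∀ c m, f (act (φ c) m) = act' (ψ c) (f m)) (z : C.carrier ⊗[R] M.carrier) :
    TensorProduct.map .id f (C.twistedD M act φ z) =
      C.twistedD N act' ψ (TensorProduct.map .id f z) := by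
  induction z with
  | zero => simp only [map_zero]
  | add a b ha hb => simp only [map_add, ha, hb]
  | tmul c m =>
    have hc := C.lTensor_cap f h (c ⊗ₜ m)
    rw [TensorProduct.map_tmul, LinearMap.id_apply] at hc
    rw [TensorProduct.map_tmul, LinearMap.id_apply, twistedD_tmul, twistedD_tmul, map_add, map_add,
      hc, TensorProduct.map_tmul, TensorProduct.map_tmul, LinearMap.id_apply, LinearMap.id_apply, hd]

/-- An isomorphism of complexes that is compatible with the actions of the values of the twisting
cochains induces an isomorphism of twisted tensor products. -/
theorem isIso_lTensor {f : M.carrier ≃ₗ[R] N.carrier} (hf : DGModule.IsIso f)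
    (h : ∀ c m, f (act (φ c) m) = act' (ψ c) (f m)) :
    DGModule.IsIso (C := C.twistedTensor M act φ) (D := C.twistedTensor N act' ψ)
      (TensorProduct.congr (.refl R C.carrier) f) := by
  refine ⟨fun n => ?_, fun z => C.lTensor_twistedD f.toLinearMap hf.2 h z⟩
  change Submodule.map (TensorProduct.map .id f.toLinearMap) (⨆ p : {p : ℕ × ℕ // p.1 + p.2 = n},
    Submodule.map₂ (TensorProduct.mk R C.carrier M.carrier) (C.gr p.1.1) (M.gr p.1.2)) =
    ⨆ p : {p : ℕ × ℕ // p.1 + p.2 = n},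
      Submodule.map₂ (TensorProduct.mk R C.carrier N.carrier) (C.gr p.1.1) (N.gr p.1.2)
  rw [Submodule.map_iSup]
  refine iSup_congr fun p => ?_
  rw [← hf.1, Submodule.map_map₂, Submodule.map₂_map_right]
  rfl

end DGCoalgebra

end

theorem mainTheorem7 (R : Type t) [CommRing R] (X : SSet.{u}) (hX : OneReduced X) :
    (simplicialChains R X).IsOneReducedDGCoalgebra ∧
    (∃ f : ((cubicalLoops X).chains R).carrier ≃ₗ[R] (simplicialChains R X).cobar.carrier,
      (((cubicalLoops X).chains R).IsChainComplex ∧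
        (simplicialChains R X).cobar.IsChainComplex ∧ DGModule.IsIso f ∧
        f ((cubicalLoops X).chain R (cubicalLoops X).one) = (1 : (simplicialChains R X).CobarAlgebra) ∧
        (∀ a b, f ((cubicalLoops X).chain R ((cubicalLoops X).mul a b)) =
          (simplicialChains R X).cobarMul (f ((cubicalLoops X).chain R a))
            (f ((cubicalLoops X).chain R b))) ∧
        ∀ x : Simplex X, 2 ≤ x.dim →
          f ((cubicalLoops X).chain R ((universalTwistingFunction X).toFun x)) =
            (simplicialChains R X).letter (x.chain R)) ∧
      ((simplicialChains R X).IsTwistingCochain (simplicialChains R X).cobar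
          (simplicialChains R X).cobarMul (simplicialChains R X).universalCochain ∧
        ((cubicalPaths X).chains R).IsChainComplex ∧
        (simplicialChains R X).acyclicCobar.IsChainComplex ∧
        ∃ g : ((cubicalPaths X).chains R).carrier ≃ₗ[R] (simplicialChains R X).acyclicCobar.carrier,
          DGModule.IsIso g ∧
          ∀ x y, g ((cubicalPaths X).chain R (twistedProduct.pair _ _ x y)) =
            x.chain R ⊗ₜ[R] f ((cubicalLoops X).chain R y))) ∧
    ∀ (Q : MonoidalCubicalSet.{v}) (L : CubicalModule.{v, w} Q) (τ : TruncatingTwistingFunction X Q),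
      (simplicialChains R X).IsTwistingCochain (Q.chains R) (Q.selfModule.chainAct R)
          (τ.cochain R) ∧
        ((twistedProduct τ L).chains R).IsChainComplex ∧
        ((simplicialChains R X).twistedTensor (L.chains R) (L.chainAct R)
          (τ.cochain R)).IsChainComplex ∧
        ∃ h : ((twistedProduct τ L).chains R).carrier ≃ₗ[R]
            ((simplicialChains R X).twistedTensor (L.chains R) (L.chainAct R)
              (τ.cochain R)).carrier,
          DGModule.IsIso h ∧
          ∀ x y, h ((twistedProduct τ L).chain R (twistedProduct.pair τ L x y)) =
            x.chain R ⊗ₜ[R] L.chain R y := by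

  have hf := LoopSet.isIso_cobarEquiv R hX
  have hpaths := TwistedProduct.isIso_tensorEquiv R (universalTwistingFunction X)
    (cubicalLoops X).selfModule
  have hcochain (c : (simplicialChains R X).carrier) :
      LoopSet.cobarEquiv R hX ((universalTwistingFunction X).cochain R c) =
        (simplicialChains R X).universalCochain c :=
    LinearMap.congr_fun (LoopSet.toCobar_cochain R hX) c
  have hg := hpaths.trans ((simplicialChains R X).isIso_lTensor
    (M := (cubicalLoops X).selfModule.toCubicalSet.chains R) (N := (simplicialChains R X).cobar)
    (act := (cubicalLoops X).selfModule.chainAct R) (act' := (simplicialChains R X).cobarMul)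
    (φ := (universalTwistingFunction X).cochain R) (ψ := (simplicialChains R X).universalCochain)
    hf fun c m => by
      rw [← hcochain]
      exact LoopSet.toCobar_chainMul R _ m)
  have hloopsComplex := CubicalSet.isChainComplex_chains R (cubicalLoops X).toCubicalSet
  have hpathsComplex := CubicalSet.isChainComplex_chains R (cubicalPaths X)
  refine ⟨Simplex.isOneReducedDGCoalgebra_chains R hX, ⟨LoopSet.cobarEquiv R hX,
    ⟨hloopsComplex, hloopsComplex.of_isIso hf, hf, ?_, ?_, ?_⟩,
    LoopSet.isTwistingCochain_universalCochain R hX, hpathsComplex, hpathsComplex.of_isIso hg, _,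
    hg, ?_⟩, ?_⟩
  · exact LoopSet.toCobar_wordCell R []
  · intro a b
    refine Eq.trans ?_ (LoopSet.toCobar_chainMul R _ _)
    exact congrArg (LoopSet.toCobar R X) (MonoidalCubicalSet.chainMul_cell R _ a b).symm
  · intro x hx
    exact (LoopSet.toCobar_wordCell R (LoopWord.bar x)).trans (LoopWord.letters_bar R hx)
  · intro x y
    exact congrArg (TensorProduct.congr (.refl R _) (LoopSet.cobarEquiv R hX))
      (TwistedProduct.toTensor_pairCell (R := R) (universalTwistingFunction X)
        (cubicalLoops X).selfModule x y)
  · intro Q L τ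
    have hL := TwistedProduct.isIso_tensorEquiv R τ L
    have hprod := CubicalSet.isChainComplex_chains R (twistedProduct τ L)
    exact ⟨τ.isTwistingCochain_cochain R, hprod, hprod.of_isIso hL, _, hL,
      TwistedProduct.toTensor_pairCell τ L⟩
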